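/- Let $\mathbf x\sim\mathcal N(0,\sigma_x^2)$, $\mathbf v\sim\mathcal N(0,\sigma_v^2)$ and $\mathbf w\sim\mathcal N(0,\sigma_w^2)$ be independent with $\sigma_x,\sigma_v,\sigma_w>0$, and let $b\in\mathbb R$ and $\theta>0$. An encoder strategy is a Borel function $\gamma^e:\mathbb R\to\mathbb R$. A decoder strategy is a pair consisting of a number $\alpha\in[0,1]$ and a Borel function $\gamma^d:\mathbb R\to\mathbb R$. The decoder observes $$\mathbf r=\alpha(\gamma^e(\mathbf x)+\mathbf v)+(1-\alpha)(\mathbf x+\mathbf w)$$ and forms the estimate $\hat{\mathbf x}=\gamma^d(\mathbf r)$. The costs, with values in $[0,\infty]$, are $$J^d=\mathbf E[(\mathbf x-\hat{\mathbf x})^2],\qquad J^e=\mathbf E[(\mathbf x-\hat{\mathbf x}-b)^2+\theta\,\gamma^e(\mathbf x)^2].$$ A Stackelberg equilibrium (with the encoder as leader) consists of an encoder strategy $\gamma^{e}$ and a map $\delta$ assigning to every encoder strategy $\gamma$ a decoder strategy $\delta(\gamma)$, such that for every $\gamma$ the decoder strategy $\delta(\gamma)$ minimizes $J^d(\gamma,\cdot)$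 over all decoder strategies, and $J^e(\gamma^{e},\delta(\gamma^{e}))\le J^e(\gamma,\delta(\gamma))$ for every encoder strategy $\gamma$. **Theorem.** Let $A\ge 0$ be given by $$A^2=\begin{cases}\sqrt{\dfrac{\sigma_v^2}{\theta\sigma_x^2}}-\dfrac{\sigma_v^2}{\sigma_x^2}\Bigl(\dfrac{\sigma_x^2}{\sigma_w^2}+1\Bigr), & \text{if } \theta<\dfrac{\sigma_x^2}{\sigma_v^2\bigl(\frac{\sigma_x^2}{\sigma_w^2}+1\bigr)^2},\\[2ex] 0, & \text{otherwise,}\end{cases}$$ so that $A>0$ exactly in the first case, and put $$\alpha=\frac{A\sigma_w^2}{A\sigma_w^2+\sigma_v^2},\qquad K=\frac{A\sigma_x^2\sigma_w^2+\sigma_x^2\sigma_v^2}{A^2\sigma_x^2\sigma_w^2+\sigma_x^2\sigma_v^2+\sigma_w^2\sigma_v^2}\ge 0,\qquad J^{d,*}=\frac{\sigma_x^2\sigma_w^2\sigma_v^2}{(A^2\sigma_w^2+\sigma_v^2)\sigma_x^2+\sigma_w^2\sigma_v^2}.$$ Then there is a Stackelberg equilibrium in which the encoder uses $\gamma^e(x)=Ax$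 and the decoder responds to it with the ratio $\alpha$ and the estimator $\gamma^d(r)=Kr$. It is the only equilibrium, affine or not: in every Stackelberg equilibrium $(\gamma^e,\delta)$, $\gamma^e(x)=Ax$ for Lebesgue-almost every $x$, and the decoder strategy $\delta(\gamma^e)$ consists of the ratio $\alpha$ and an estimator $\gamma^d$ with $\gamma^d(r)=Kr$ for Lebesgue-almost every $r$. At every equilibrium the decoder cost is $J^{d,*}$ and the encoder cost is $$J^{e,*}=J^{d,*}+\theta A^2\sigma_x^2+b^2 .$$ -/

import Mathlib

open MeasureTheory ProbabilityTheory
open scoped ENNReal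

noncomputable section

namespace SignalingGame

/-- An encoder strategy: a Borel measurable map sending the source value `x` to the message. No
linearity and no bound on the transmit power is imposed. -/
structure Encoder where
  /-- the message sent for a given source value -/
  message : ℝ → ℝ
  measurable_message : Measurable message

/-- A decoder strategy: a combining ratio in `[0, 1]` together with a Borel measurable estimator
of the source from the combined observation. -/
structure Decoder where
  /-- the combining and utilization ratio of the channel from the encoder -/
  ratio : ℝ
  ratio_mem : ratio ∈ Set.Icc (0 : ℝ) 1
  /-- the estimate of the source as a function of the combined observation -/
  estimate : ℝ → ℝ
  measurable_estimate : Measurable estimate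

/-- The linear encoder `x ↦ A * x`. -/
def Encoder.linear (A : ℝ) : Encoder where
  message := fun x => A * x
  measurable_message := measurable_const_mul A

variable {Ω : Type*}

/-- The decoder input `r = α * y + (1 - α) * z`, with `y = γ(x) + v` and `z = x + w`. -/
def received (X V W : Ω → ℝ) (γ : Encoder) (α : ℝ) (ω : Ω) : ℝ :=
  α * (γ.message (X ω) + V ω) + (1 - α) * (X ω + W ω)

/-- The estimate of the source produced by the pair of strategies `(γ, d)`. -/
def reconstruction (X V W : Ω → ℝ) (γ : Encoder) (d : Decoder) (ω : Ω) : ℝ :=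
  d.estimate (received X V W γ d.ratio ω)

variable [MeasurableSpace Ω]

/-- The expected decoder cost, the expectation of `(x - x̂)²`. The integrand is nonnegative, and
the expectation is taken in `[0, ∞]`. -/
def decoderCost (P : Measure Ω) (X V W : Ω → ℝ) (γ : Encoder) (d : Decoder) : ℝ≥0∞ :=
  ∫⁻ ω, ENNReal.ofReal ((X ω - reconstruction X V W γ d ω) ^ 2) ∂P

/-- The expected encoder cost, the expectation of `(x - x̂ - b)² + θ * γ(x)²`. For `0 ≤ θ` the
integrand is nonnegative, and the expectation is taken in `[0, ∞]`. -/
def encoderCost (P : Measure Ω) (X V W : Ω → ℝ) (b θ : ℝ) (γ : Encoder) (d : Decoder) : ℝ≥0∞ :=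
  ∫⁻ ω, ENNReal.ofReal
    ((X ω - reconstruction X V W γ d ω - b) ^ 2 + θ * (γ.message (X ω)) ^ 2) ∂P

/-- The follower strategy `d` is an optimal reaction to the announced encoder strategy `γ`. -/
def IsBestResponse (P : Measure Ω) (X V W : Ω → ℝ) (γ : Encoder) (d : Decoder) : Prop :=
  ∀ d' : Decoder, decoderCost P X V W γ d ≤ decoderCost P X V W γ d'

/-- Stackelberg equilibrium with the encoder as leader: `δ` assigns to each announced encoder
strategy an optimal reaction of the decoder, and `γ` minimizes the encoder cost when this reaction
is anticipated. -/
structure IsStackelbergEquilibrium (P : Measure Ω) (X V W : Ω → ℝ) (b θ : ℝ)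
    (γ : Encoder) (δ : Encoder → Decoder) : Prop where
  follower : ∀ γ' : Encoder, IsBestResponse P X V W γ' (δ γ')
  leader : ∀ γ' : Encoder,
    encoderCost P X V W b θ γ (δ γ) ≤ encoderCost P X V W b θ γ' (δ γ')

end SignalingGame

end

noncomputable section

namespace SignalingGame

open scoped NNReal

/-! ### Additive Gaussian noise channels -/

/-! For a fixed ratio `α` the decoder sees `s x + n`, where `s` is the combined signal and `n` is
independent Gaussian noise of variance `N`. Gibbs' inequality against a Gaussian competitor density
gives, for every signal of power `S` and every estimator, mean square error at least `σx² N / (S +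
N)` (`channelError_ge`). By Cauchy-Schwarz and a completed square (`snr_gap`), an encoder of power
`a² σx²` achieves `S / N` at most `σx² / σw² + a² σx² / σv²`. Equality determines `α` and makes the
message equal to `a x` almost everywhere. Hence nonlinear encoders cannot beat linear ones of the
same power (`minError_le_decoderCost`, `eq_of_decoderCost_le_minError`).

An optimal reaction has mean error zero, so the encoder cost is the decoder cost plus `b²` plus the
power term (`IsBestResponse.encoderCost_eq`). The leader therefore minimizes the strictly convex
function `minError q + θ q σx²` over `q ≥ 0`, whose only minimizer is `A²`.

An equilibrium also needs an optimal reaction to every encoder, even one of infinite power.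
Posterior means are optimal at each ratio, and the resulting error is lower semicontinuous in the
ratio by Fatou, so it attains its minimum on `[0, 1]` (`exists_channelError_le`). Almost everywhere
uniqueness of the posterior mean identifies the estimator (`ae_eq_posteriorMean`). -/

lemma integral_sq_gaussianReal (v : ℝ≥0) : ∫ x, x ^ 2 ∂(gaussianReal 0 v) = v := by
  have h := variance_fun_id_gaussianReal (μ := 0) (v := v)
  rwa [variance_of_integral_eq_zero (by fun_prop) (by simp)] at h

lemma integrable_sq_gaussianReal (v : ℝ≥0) : Integrable (fun x => x ^ 2) (gaussianReal 0 v) :=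
  (memLp_id_gaussianReal 2).integrable_sq

lemma integrable_id_gaussianReal (v : ℝ≥0) : Integrable (fun x => x) (gaussianReal 0 v) :=
  (memLp_id_gaussianReal 1).integrable le_rfl

/-- Integration over the input and output of a Gaussian noise channel, through the transition
density. -/
lemma lintegral_channel (μ : Measure ℝ) [SFinite μ] {v : ℝ≥0} (hv : v ≠ 0) {s : ℝ → ℝ}
    (hs : Measurable s) {f : ℝ → ℝ → ℝ≥0∞} (hf : Measurable (Function.uncurry f)) :
    ∫⁻ z, f z.1 (s z.1 + z.2) ∂(μ.prod (gaussianReal 0 v)) =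
      ∫⁻ r, ∫⁻ x, f x r * gaussianPDF 0 v (r - s x) ∂μ := by
  have hm : Measurable fun z : ℝ × ℝ => f z.1 (s z.1 + z.2) :=
    hf.comp (measurable_fst.prodMk ((hs.comp measurable_fst).add measurable_snd))
  have hm' : Measurable fun z : ℝ × ℝ => f z.1 z.2 * gaussianPDF 0 v (z.2 - s z.1) :=
    hf.mul ((measurable_gaussianPDF 0 v).comp (measurable_snd.sub (hs.comp measurable_fst)))
  rw [lintegral_prod _ hm.aemeasurable,
    ← lintegral_lintegral_swap (f := fun x r => f x r * gaussianPDF 0 v (r - s x))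
      hm'.aemeasurable]
  refine lintegral_congr fun x => ?_
  have hx : Measurable fun n => f x (s x + n) :=
    hf.comp (measurable_const.prodMk (measurable_const.add measurable_id))
  -- For fixed input, Lebesgue measure is invariant under the shift from noise to output.
  rw [gaussianReal_of_var_ne_zero 0 hv, lintegral_withDensity_eq_lintegral_mul _
    (measurable_gaussianPDF 0 v) hx,
    ← lintegral_add_right_eq_self (fun r => f x r * gaussianPDF 0 v (r - s x)) (s x)]
  refine lintegral_congr fun n => ?_
  simp [mul_comm, add_comm]

/-- The mean square error of the estimator `g` when the signal `s x` is received in Gaussian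
noise. -/
def channelError (vx vn : ℝ≥0) (s g : ℝ → ℝ) : ℝ≥0∞ :=
  ∫⁻ z, ENNReal.ofReal ((z.1 - g (s z.1 + z.2)) ^ 2)
    ∂((gaussianReal 0 vx).prod (gaussianReal 0 vn))

/-- The exponential cancels the exponents of the source and noise densities and inserts those of the
competitor; `h` is exactly what makes the normalizing constants agree. -/
lemma gaussianPDFReal_mul_exp_mul {vx vn vr τ : ℝ≥0} (h : vx * vn = vr * τ) (x r m y : ℝ) :
    gaussianPDFReal 0 vx x * (Real.exp (-(r ^ 2) / (2 * vr) - (x - m) ^ 2 / (2 * τ)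
      + x ^ 2 / (2 * vx) + (r - y) ^ 2 / (2 * vn)) * gaussianPDFReal 0 vn (r - y)) =
      gaussianPDFReal 0 vr r * gaussianPDFReal m τ x := by
  have hc : (√(2 * Real.pi * vx))⁻¹ * (√(2 * Real.pi * vn))⁻¹ =
      (√(2 * Real.pi * vr))⁻¹ * (√(2 * Real.pi * τ))⁻¹ := by
    have h' : (vx : ℝ) * vn = vr * τ := by exact_mod_cast h
    rw [← mul_inv, ← mul_inv, ← Real.sqrt_mul (by positivity), ← Real.sqrt_mul (by positivity)]
    congr 2
    linear_combination (2 * Real.pi) ^ 2 * h'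
  simp only [gaussianPDFReal]
  calc _ = ((√(2 * Real.pi * vx))⁻¹ * (√(2 * Real.pi * vn))⁻¹) *
        (Real.exp (-(x - 0) ^ 2 / (2 * vx)) * Real.exp (-(r ^ 2) / (2 * vr)
          - (x - m) ^ 2 / (2 * τ) + x ^ 2 / (2 * vx) + (r - y) ^ 2 / (2 * vn)) *
          Real.exp (-(r - y - 0) ^ 2 / (2 * vn))) := by ring
    _ = ((√(2 * Real.pi * vr))⁻¹ * (√(2 * Real.pi * τ))⁻¹) *
        (Real.exp (-(r - 0) ^ 2 / (2 * vr)) * Real.exp (-(x - m) ^ 2 / (2 * τ))) := by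
      rw [hc, ← Real.exp_add, ← Real.exp_add, ← Real.exp_add]
      ring_nf
    _ = _ := by ring

/-- The exponential of the log-ratio of a Gaussian competitor density to the joint density of
input and output integrates to one. -/
lemma lintegral_exp_channel {vx vn vr τ : ℝ≥0} (hvx : vx ≠ 0) (hvn : vn ≠ 0)
    (hvr : vr ≠ 0) (hτ : τ ≠ 0) (h : vx * vn = vr * τ) {s g : ℝ → ℝ} (hs : Measurable s)
    (hg : Measurable g) :
    ∫⁻ z, ENNReal.ofReal (Real.exp (-((s z.1 + z.2) ^ 2) / (2 * vr)
      - (z.1 - g (s z.1 + z.2)) ^ 2 / (2 * τ) + z.1 ^ 2 / (2 * vx) + z.2 ^ 2 / (2 * vn)))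
      ∂((gaussianReal 0 vx).prod (gaussianReal 0 vn)) = 1 := by
  have hf : Measurable (Function.uncurry fun x r : ℝ => ENNReal.ofReal
      (Real.exp (-(r ^ 2) / (2 * vr) - (x - g r) ^ 2 / (2 * τ) + x ^ 2 / (2 * vx)
        + (r - s x) ^ 2 / (2 * vn)))) := by
    unfold Function.uncurry
    fun_prop
  have key := lintegral_channel (gaussianReal 0 vx) hvn hs hf
  simp only [add_sub_cancel_left] at key
  rw [key]
  have inner : ∀ r : ℝ, ∫⁻ x, ENNReal.ofReal
      (Real.exp (-(r ^ 2) / (2 * vr) - (x - g r) ^ 2 / (2 * τ) + x ^ 2 / (2 * vx)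
        + (r - s x) ^ 2 / (2 * vn))) * gaussianPDF 0 vn (r - s x) ∂(gaussianReal 0 vx) =
      gaussianPDF 0 vr r := by
    intro r
    have hm : Measurable fun x : ℝ => ENNReal.ofReal
        (Real.exp (-(r ^ 2) / (2 * vr) - (x - g r) ^ 2 / (2 * τ) + x ^ 2 / (2 * vx)
          + (r - s x) ^ 2 / (2 * vn))) * gaussianPDF 0 vn (r - s x) := by
      fun_prop
    rw [gaussianReal_of_var_ne_zero 0 hvx, lintegral_withDensity_eq_lintegral_mul _
      (measurable_gaussianPDF 0 vx) hm]
    calc _ = ∫⁻ x, gaussianPDF 0 vr r * gaussianPDF (g r) τ x := by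
          refine lintegral_congr fun x => ?_
          simp only [Pi.mul_apply, gaussianPDF]
          rw [← ENNReal.ofReal_mul (by positivity), ← ENNReal.ofReal_mul
            (gaussianPDFReal_nonneg _ _ _), ← ENNReal.ofReal_mul
            (gaussianPDFReal_nonneg _ _ _), gaussianPDFReal_mul_exp_mul h]
      _ = gaussianPDF 0 vr r := by
          rw [lintegral_const_mul _ (measurable_gaussianPDF _ _),
            lintegral_gaussianPDF_eq_one _ hτ, mul_one]
  simp_rw [inner]
  exact lintegral_gaussianPDF_eq_one _ hvr

/-! ### Second moments of the input, noise and output of the channel -/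

section Moments

variable {vx vn : ℝ≥0} {s : ℝ → ℝ}

lemma integrable_channel_fst_sq :
    Integrable (fun z : ℝ × ℝ => z.1 ^ 2) ((gaussianReal 0 vx).prod (gaussianReal 0 vn)) :=
  (integrable_sq_gaussianReal vx).comp_fst _

lemma integrable_channel_snd_sq :
    Integrable (fun z : ℝ × ℝ => z.2 ^ 2) ((gaussianReal 0 vx).prod (gaussianReal 0 vn)) :=
  (integrable_sq_gaussianReal vn).comp_snd _

lemma integral_channel_fst_sq :
    ∫ z, z.1 ^ 2 ∂((gaussianReal 0 vx).prod (gaussianReal 0 vn)) = vx := by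
  rw [integral_fun_fst (fun x : ℝ => x ^ 2)]
  simp [integral_sq_gaussianReal]

lemma integral_channel_snd_sq :
    ∫ z, z.2 ^ 2 ∂((gaussianReal 0 vx).prod (gaussianReal 0 vn)) = vn := by
  rw [integral_fun_snd (fun x : ℝ => x ^ 2)]
  simp [integral_sq_gaussianReal]

lemma integrable_channel_output_sq (hs : MemLp s 2 (gaussianReal 0 vx)) :
    Integrable (fun z : ℝ × ℝ => (s z.1 + z.2) ^ 2)
      ((gaussianReal 0 vx).prod (gaussianReal 0 vn)) := by
  have h1 : MemLp (fun z : ℝ × ℝ => s z.1) 2 ((gaussianReal 0 vx).prod (gaussianReal 0 vn)) :=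
    hs.comp_fst _
  have h2 : MemLp (fun z : ℝ × ℝ => z.2) 2 ((gaussianReal 0 vx).prod (gaussianReal 0 vn)) :=
    (memLp_id_gaussianReal 2).comp_snd _
  exact (h1.add h2).integrable_sq

lemma integral_channel_output_sq (hs : MemLp s 2 (gaussianReal 0 vx)) :
    ∫ z, (s z.1 + z.2) ^ 2 ∂((gaussianReal 0 vx).prod (gaussianReal 0 vn)) =
      ∫ x, s x ^ 2 ∂(gaussianReal 0 vx) + vn := by
  have h1 : Integrable (fun z : ℝ × ℝ => s z.1 ^ 2)
      ((gaussianReal 0 vx).prod (gaussianReal 0 vn)) := hs.integrable_sq.comp_fst _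
  have h2 : Integrable (fun z : ℝ × ℝ => s z.1 * z.2)
      ((gaussianReal 0 vx).prod (gaussianReal 0 vn)) :=
    (hs.integrable one_le_two).mul_prod (integrable_id_gaussianReal vn)
  have h3 := integral_prod_mul (μ := gaussianReal 0 vx) (ν := gaussianReal 0 vn) s (fun n => n)
  have e : ∀ z : ℝ × ℝ, (s z.1 + z.2) ^ 2 = s z.1 ^ 2 + 2 * (s z.1 * z.2) + z.2 ^ 2 :=
    fun z => by ring
  have h12 : Integrable (fun z : ℝ × ℝ => s z.1 ^ 2 + 2 * (s z.1 * z.2))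
      ((gaussianReal 0 vx).prod (gaussianReal 0 vn)) := h1.add (h2.const_mul 2)
  simp_rw [e]
  rw [integral_add h12 integrable_channel_snd_sq,
    integral_add h1 (h2.const_mul 2), integral_const_mul, h3, integral_channel_snd_sq,
    integral_fun_fst (fun x : ℝ => s x ^ 2)]
  simp

end Moments

/-- No estimator of a Gaussian source from a signal in Gaussian noise beats the linear estimator
at the same signal power, whatever the (possibly nonlinear) signal. -/
theorem channelError_ge {vx vn : ℝ≥0} (hvx : vx ≠ 0) (hvn : vn ≠ 0) {s g : ℝ → ℝ}
    (hs : Measurable s) (hs2 : MemLp s 2 (gaussianReal 0 vx)) (hg : Measurable g) :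
    ENNReal.ofReal (vx * vn / (∫ x, s x ^ 2 ∂(gaussianReal 0 vx) + vn)) ≤
      channelError vx vn s g := by
  set S : ℝ≥0 := ⟨∫ x, s x ^ 2 ∂(gaussianReal 0 vx), integral_nonneg fun x => sq_nonneg _⟩
  have hS' : ∫ x, s x ^ 2 ∂(gaussianReal 0 vx) = S := rfl
  -- The competitor output variance is the true second moment of the output, so its quadratic term
  -- integrates to `-1/2`. The competitor error variance `τ` is the claimed bound.
  set vr : ℝ≥0 := S + vn
  have hvr : vr ≠ 0 := (lt_of_lt_of_le (pos_iff_ne_zero.2 hvn) le_add_self).ne'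
  set τ : ℝ≥0 := vx * vn / vr with hτdef
  have hτ : τ ≠ 0 := div_ne_zero (mul_ne_zero hvx hvn) hvr
  have hprod : vx * vn = vr * τ := by rw [hτdef, mul_div_cancel₀ _ hvr]
  have hτ' : (vx * vn / (∫ x, s x ^ 2 ∂(gaussianReal 0 vx) + vn) : ℝ) = τ := by
    rw [hS', hτdef]; push_cast; rfl
  rw [hτ']
  set M := (gaussianReal 0 vx).prod (gaussianReal 0 vn)
  -- A finite error is needed for the log-ratio `Q` to be integrable.
  by_cases hfin : channelError vx vn s g = ∞
  · simp [hfin]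
  have hmeas : Measurable fun z : ℝ × ℝ => (z.1 - g (s z.1 + z.2)) ^ 2 := by fun_prop
  have herr : Integrable (fun z : ℝ × ℝ => (z.1 - g (s z.1 + z.2)) ^ 2) M := by
    refine (lintegral_ofReal_ne_top_iff_integrable hmeas.aestronglyMeasurable
      (Filter.Eventually.of_forall fun z => sq_nonneg _)).1 hfin
  rw [channelError, ← ofReal_integral_eq_lintegral_ofReal herr
    (Filter.Eventually.of_forall fun z => sq_nonneg _)]
  refine ENNReal.ofReal_le_ofReal ?_
  set Q : ℝ × ℝ → ℝ := fun z => -((s z.1 + z.2) ^ 2) / (2 * vr)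
      - (z.1 - g (s z.1 + z.2)) ^ 2 / (2 * τ) + z.1 ^ 2 / (2 * vx) + z.2 ^ 2 / (2 * vn) with hQ
  have i1 : Integrable (fun z : ℝ × ℝ => -((s z.1 + z.2) ^ 2) / (2 * vr)) M :=
    (integrable_channel_output_sq hs2).neg.div_const _
  have i2 := herr.div_const (2 * (τ : ℝ))
  have i3 : Integrable (fun z : ℝ × ℝ => z.1 ^ 2 / (2 * (vx : ℝ))) M :=
    integrable_channel_fst_sq.div_const _
  have i4 : Integrable (fun z : ℝ × ℝ => z.2 ^ 2 / (2 * (vn : ℝ))) M :=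
    integrable_channel_snd_sq.div_const _
  have i12 : Integrable (fun z : ℝ × ℝ => -((s z.1 + z.2) ^ 2) / (2 * vr)
      - (z.1 - g (s z.1 + z.2)) ^ 2 / (2 * τ)) M := i1.sub i2
  have i123 : Integrable (fun z : ℝ × ℝ => -((s z.1 + z.2) ^ 2) / (2 * vr)
      - (z.1 - g (s z.1 + z.2)) ^ 2 / (2 * τ) + z.1 ^ 2 / (2 * vx)) M := i12.add i3
  have hQi : Integrable Q M := i123.add i4
  have hQm : Measurable Q := by rw [hQ]; fun_prop
  have hexp := lintegral_exp_channel hvx hvn hvr hτ hprod hs hg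
  have hexpi : Integrable (fun z => Real.exp (Q z)) M := by
    refine (lintegral_ofReal_ne_top_iff_integrable hQm.exp.aestronglyMeasurable
      (Filter.Eventually.of_forall fun z => (Real.exp_pos _).le)).1 ?_
    rw [hexp]; simp
  have hexp1 : ∫ z, Real.exp (Q z) ∂M = 1 := by
    rw [integral_eq_lintegral_of_nonneg_ae
      (Filter.Eventually.of_forall fun z => (Real.exp_pos _).le)
      hQm.exp.aestronglyMeasurable, hexp]
    simp
  -- Gibbs' inequality: `1 + Q ≤ exp Q` and `exp Q` has mean one, so `Q` has mean at most zero.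
  have hle : ∫ z, (Q z + 1) ∂M ≤ ∫ z, Real.exp (Q z) ∂M :=
    integral_mono (hQi.add (integrable_const 1)) hexpi fun z => Real.add_one_le_exp _
  rw [hexp1, integral_add hQi (integrable_const 1)] at hle
  have hQint : ∫ z, Q z ∂M = -(vr : ℝ) / (2 * vr)
      - (∫ z, (z.1 - g (s z.1 + z.2)) ^ 2 ∂M) / (2 * τ) + vx / (2 * vx) + vn / (2 * vn) := by
    rw [hQ, integral_add i123 i4, integral_add i12 i3, integral_sub i1 i2,
      integral_div, integral_div, integral_div, integral_div, integral_neg,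
      integral_channel_output_sq hs2, integral_channel_fst_sq, integral_channel_snd_sq, hS']
    rfl
  have hvr' : (0 : ℝ) < vr := by exact_mod_cast pos_iff_ne_zero.2 hvr
  have hτ0 : (0 : ℝ) < τ := by exact_mod_cast pos_iff_ne_zero.2 hτ
  have hvx' : (0 : ℝ) < vx := by exact_mod_cast pos_iff_ne_zero.2 hvx
  have hvn' : (0 : ℝ) < vn := by exact_mod_cast pos_iff_ne_zero.2 hvn
  rw [hQint] at hle
  have e1 : -(vr : ℝ) / (2 * vr) = -1 / 2 := by field_simp
  have e2 : (vx : ℝ) / (2 * vx) = 1 / 2 := by field_simp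
  have e3 : (vn : ℝ) / (2 * vn) = 1 / 2 := by field_simp
  rw [e1, e2, e3] at hle
  simp only [integral_const, probReal_univ, smul_eq_mul, mul_one] at hle
  have : (1 : ℝ) / 2 ≤ (∫ z, (z.1 - g (s z.1 + z.2)) ^ 2 ∂M) / (2 * τ) := by linarith
  rw [le_div_iff₀ (by positivity)] at this
  linarith

/-! ### Existence of optimal estimators and ratios -/

/-- The bound is uniform over variances at least `c`; it supplies the dominating function when the
noise variance moves with the ratio. -/
lemma gaussianPDFReal_le_inv_sqrt {c v : ℝ≥0} (hc : 0 < c) (h : c ≤ v) (m x : ℝ) :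
    gaussianPDFReal m v x ≤ (√(2 * Real.pi * c))⁻¹ := by
  have hc' : (0 : ℝ) < c := by exact_mod_cast hc
  have h' : (c : ℝ) ≤ v := by exact_mod_cast h
  have hle : √(2 * Real.pi * c) ≤ √(2 * Real.pi * v) := by gcongr
  have he : Real.exp (-(x - m) ^ 2 / (2 * v)) ≤ 1 :=
    Real.exp_le_one_iff.2 (div_nonpos_of_nonpos_of_nonneg (by nlinarith [sq_nonneg (x - m)])
      (by positivity))
  calc gaussianPDFReal m v x ≤ (√(2 * Real.pi * v))⁻¹ * 1 := by
        rw [gaussianPDFReal]; gcongr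
    _ ≤ (√(2 * Real.pi * c))⁻¹ := by
        rw [mul_one]
        exact inv_anti₀ (Real.sqrt_pos.2 (by positivity)) hle

/-! ### Posterior moments and optimal estimation at a fixed ratio -/

section Posterior

variable (vx : ℝ≥0) (v : ℝ≥0) (s : ℝ → ℝ)

/-- The unnormalized posterior moment of order `k` of the source, given the channel output
`r`. -/
def posteriorMoment (k : ℕ) (r : ℝ) : ℝ :=
  ∫ x, x ^ k * gaussianPDFReal 0 v (r - s x) ∂(gaussianReal 0 vx)

/-- The posterior mean of the source, given the channel output `r`. -/
def posteriorMean (r : ℝ) : ℝ := posteriorMoment vx v s 1 r / posteriorMoment vx v s 0 r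

/-- The unnormalized posterior variance of the source, given the channel output `r`. -/
def posteriorSpread (r : ℝ) : ℝ :=
  posteriorMoment vx v s 2 r - posteriorMoment vx v s 1 r ^ 2 / posteriorMoment vx v s 0 r

variable {vx v s}

lemma integrable_pow_gaussianReal (k : ℕ) : Integrable (fun x => x ^ k) (gaussianReal 0 vx) := by
  simpa using (memLp_id_gaussianReal (μ := 0) (v := vx) k).integrable_norm_pow' |>.mono
    (by fun_prop) (Filter.Eventually.of_forall fun x => by simp)

lemma integrable_posteriorMoment (hv : v ≠ 0) (hs : Measurable s) (k : ℕ) (r : ℝ) :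
    Integrable (fun x => x ^ k * gaussianPDFReal 0 v (r - s x)) (gaussianReal 0 vx) := by
  refine (integrable_pow_gaussianReal k).mul_bdd (c := (√(2 * Real.pi * v))⁻¹)
    (Measurable.aestronglyMeasurable (by fun_prop)) (Filter.Eventually.of_forall fun x => ?_)
  rw [Real.norm_of_nonneg (gaussianPDFReal_nonneg _ _ _)]
  exact gaussianPDFReal_le_inv_sqrt (pos_iff_ne_zero.2 hv) le_rfl _ _

lemma measurable_posteriorMoment (hs : Measurable s) (k : ℕ) :
    Measurable (posteriorMoment vx v s k) := by
  refine StronglyMeasurable.measurable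
    (StronglyMeasurable.integral_prod_right (ν := gaussianReal 0 vx)
    (f := fun r x => x ^ k * gaussianPDFReal 0 v (r - s x)) ?_)
  refine Measurable.stronglyMeasurable ?_
  unfold Function.uncurry
  fun_prop

lemma measurable_posteriorMean (hs : Measurable s) : Measurable (posteriorMean vx v s) :=
  (measurable_posteriorMoment hs 1).div (measurable_posteriorMoment hs 0)

lemma measurable_posteriorSpread (hs : Measurable s) : Measurable (posteriorSpread vx v s) :=
  (measurable_posteriorMoment hs 2).sub
    (((measurable_posteriorMoment hs 1).pow_const 2).div (measurable_posteriorMoment hs 0))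

/-- This moment is the density of the channel output. Its positivity everywhere justifies the
divisions by it, and lets uniqueness of the estimator hold Lebesgue-almost everywhere. -/
lemma posteriorMoment_zero_pos (hv : v ≠ 0) (hs : Measurable s) (r : ℝ) :
    0 < posteriorMoment vx v s 0 r := by
  have hi := integrable_posteriorMoment (vx := vx) hv hs 0 r
  have hpos : ∀ x, 0 < x ^ 0 * gaussianPDFReal 0 v (r - s x) := fun x => by
    simpa using gaussianPDFReal_pos 0 v _ hv
  refine (integral_pos_iff_support_of_nonneg (fun x => (hpos x).le) hi).2 ?_
  have : Function.support (fun x => x ^ 0 * gaussianPDFReal 0 v (r - s x)) = Set.univ :=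
    Set.eq_univ_of_forall fun x => (hpos x).ne'
  rw [this]
  simp

lemma integrable_sq_sub_mul_gaussianPDFReal (hv : v ≠ 0) (hs : Measurable s) (r y : ℝ) :
    Integrable (fun x => (x - y) ^ 2 * gaussianPDFReal 0 v (r - s x)) (gaussianReal 0 vx) := by
  have e : ∀ x, (x - y) ^ 2 * gaussianPDFReal 0 v (r - s x) =
      x ^ 2 * gaussianPDFReal 0 v (r - s x) - 2 * y * (x ^ 1 * gaussianPDFReal 0 v (r - s x)) +
        y ^ 2 * (x ^ 0 * gaussianPDFReal 0 v (r - s x)) := fun x => by ring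
  simp_rw [e]
  exact ((integrable_posteriorMoment hv hs 2 r).sub
    ((integrable_posteriorMoment hv hs 1 r).const_mul _)).add
    ((integrable_posteriorMoment hv hs 0 r).const_mul _)

/-- Completing the square in the estimate `y` separates the unavoidable error from the penalty for
deviating from the posterior mean. -/
lemma integral_sq_sub_mul_gaussianPDFReal (hv : v ≠ 0) (hs : Measurable s) (r y : ℝ) :
    ∫ x, (x - y) ^ 2 * gaussianPDFReal 0 v (r - s x) ∂(gaussianReal 0 vx) =
      posteriorSpread vx v s r +
        posteriorMoment vx v s 0 r * (y - posteriorMean vx v s r) ^ 2 := by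
  have i0 := integrable_posteriorMoment (vx := vx) hv hs 0 r
  have i1 := integrable_posteriorMoment (vx := vx) hv hs 1 r
  have i2 := integrable_posteriorMoment (vx := vx) hv hs 2 r
  have e : ∀ x, (x - y) ^ 2 * gaussianPDFReal 0 v (r - s x) =
      x ^ 2 * gaussianPDFReal 0 v (r - s x) - 2 * y * (x ^ 1 * gaussianPDFReal 0 v (r - s x)) +
        y ^ 2 * (x ^ 0 * gaussianPDFReal 0 v (r - s x)) := fun x => by ring
  have i21 : Integrable (fun x => x ^ 2 * gaussianPDFReal 0 v (r - s x) -
      2 * y * (x ^ 1 * gaussianPDFReal 0 v (r - s x))) (gaussianReal 0 vx) :=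
    i2.sub (i1.const_mul _)
  have hval : ∫ x, (x - y) ^ 2 * gaussianPDFReal 0 v (r - s x) ∂(gaussianReal 0 vx) =
      posteriorMoment vx v s 2 r - 2 * y * posteriorMoment vx v s 1 r +
        y ^ 2 * posteriorMoment vx v s 0 r := by
    simp_rw [e]
    rw [integral_add i21 (i0.const_mul _), integral_sub i2 (i1.const_mul _),
      integral_const_mul, integral_const_mul]
    rfl
  have h0 := (posteriorMoment_zero_pos (vx := vx) hv hs r).ne'
  rw [hval, posteriorSpread, posteriorMean]
  field_simp
  ring

lemma posteriorSpread_nonneg (hv : v ≠ 0) (hs : Measurable s) (r : ℝ) :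
    0 ≤ posteriorSpread vx v s r := by
  have h := integral_sq_sub_mul_gaussianPDFReal (vx := vx) hv hs r (posteriorMean vx v s r)
  rw [sub_self, zero_pow two_ne_zero, mul_zero, add_zero] at h
  rw [← h]
  exact integral_nonneg fun x => mul_nonneg (sq_nonneg _) (gaussianPDFReal_nonneg _ _ _)

lemma lintegral_sq_sub_mul_gaussianPDF (hv : v ≠ 0) (hs : Measurable s) (r y : ℝ) :
    ∫⁻ x, ENNReal.ofReal ((x - y) ^ 2) * gaussianPDF 0 v (r - s x) ∂(gaussianReal 0 vx) =
      ENNReal.ofReal (posteriorSpread vx v s r +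
        posteriorMoment vx v s 0 r * (y - posteriorMean vx v s r) ^ 2) := by
  rw [← integral_sq_sub_mul_gaussianPDFReal hv hs, ofReal_integral_eq_lintegral_ofReal
    (integrable_sq_sub_mul_gaussianPDFReal hv hs r y) (Filter.Eventually.of_forall fun x =>
      mul_nonneg (sq_nonneg _) (gaussianPDFReal_nonneg _ _ _))]
  simp only [gaussianPDF, ENNReal.ofReal_mul (sq_nonneg _)]

lemma channelError_eq_lintegral_posterior (hv : v ≠ 0) (hs : Measurable s) {g : ℝ → ℝ}
    (hg : Measurable g) :
    channelError vx v s g = ∫⁻ r, ENNReal.ofReal (posteriorSpread vx v s r +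
        posteriorMoment vx v s 0 r * (g r - posteriorMean vx v s r) ^ 2) := by
  rw [channelError, lintegral_channel _ hv hs (f := fun x r => ENNReal.ofReal ((x - g r) ^ 2))
    (by unfold Function.uncurry; fun_prop)]
  exact lintegral_congr fun r => lintegral_sq_sub_mul_gaussianPDF hv hs r (g r)

lemma channelError_posteriorMean (hv : v ≠ 0) (hs : Measurable s) :
    channelError vx v s (posteriorMean vx v s) =
      ∫⁻ r, ENNReal.ofReal (posteriorSpread vx v s r) := by
  simp [channelError_eq_lintegral_posterior hv hs (measurable_posteriorMean hs)]

lemma lintegral_posteriorSpread_le (hv : v ≠ 0) (hs : Measurable s) {g : ℝ → ℝ}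
    (hg : Measurable g) :
    ∫⁻ r, ENNReal.ofReal (posteriorSpread vx v s r) ≤ channelError vx v s g := by
  rw [channelError_eq_lintegral_posterior hv hs hg]
  gcongr with r
  have := (posteriorMoment_zero_pos (vx := vx) hv hs r).le
  nlinarith [mul_nonneg this (sq_nonneg (g r - posteriorMean vx v s r))]

/-- An optimal estimator agrees with the posterior mean almost everywhere. -/
lemma ae_eq_posteriorMean (hv : v ≠ 0) (hs : Measurable s) {g : ℝ → ℝ} (hg : Measurable g)
    (hfin : channelError vx v s g ≠ ∞)
    (hopt : ∀ h : ℝ → ℝ, Measurable h → channelError vx v s g ≤ channelError vx v s h) :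
    g =ᵐ[volume] posteriorMean vx v s := by
  have hle := hopt _ (measurable_posteriorMean (vx := vx) (v := v) hs)
  rw [channelError_posteriorMean hv hs] at hle
  have hmeas : Measurable fun r =>
      posteriorMoment vx v s 0 r * (g r - posteriorMean vx v s r) ^ 2 :=
    (measurable_posteriorMoment hs 0).mul ((hg.sub (measurable_posteriorMean hs)).pow_const 2)
  have hnn : ∀ r, 0 ≤ posteriorMoment vx v s 0 r * (g r - posteriorMean vx v s r) ^ 2 := fun r =>
    mul_nonneg (posteriorMoment_zero_pos hv hs r).le (sq_nonneg _)
  have hsplit : channelError vx v s g = (∫⁻ r, ENNReal.ofReal (posteriorSpread vx v s r)) +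
      ∫⁻ r, ENNReal.ofReal (posteriorMoment vx v s 0 r * (g r - posteriorMean vx v s r) ^ 2) := by
    rw [channelError_eq_lintegral_posterior hv hs hg,
      ← lintegral_add_right _ hmeas.ennreal_ofReal]
    exact lintegral_congr fun r => ENNReal.ofReal_add (posteriorSpread_nonneg hv hs r) (hnn r)
  have hzero : ∫⁻ r, ENNReal.ofReal
      (posteriorMoment vx v s 0 r * (g r - posteriorMean vx v s r) ^ 2) = 0 := by
    -- Cancellation in `[0, ∞]` requires a finite common term.
    have hne : ∫⁻ r, ENNReal.ofReal (posteriorSpread vx v s r) ≠ ∞ := fun h => by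
      rw [hsplit, h] at hfin
      simp at hfin
    rw [hsplit] at hle
    exact nonpos_iff_eq_zero.1 (ENNReal.le_of_add_le_add_left hne (by simpa using hle))
  rw [lintegral_eq_zero_iff hmeas.ennreal_ofReal] at hzero
  filter_upwards [hzero] with r hr
  have h1 := le_antisymm (ENNReal.ofReal_eq_zero.1 hr) (hnn r)
  have h2 := (mul_eq_zero.1 h1).resolve_left (posteriorMoment_zero_pos hv hs r).ne'
  exact sub_eq_zero.1 (pow_eq_zero_iff two_ne_zero |>.1 h2)

end Posterior

/-! ### Dependence of the optimal error on the ratio -/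

section Continuity

variable {vx c : ℝ≥0} {v : ℝ → ℝ≥0} {s : ℝ → ℝ → ℝ}

lemma continuous_posteriorMoment (hc : 0 < c) (hcv : ∀ α, c ≤ v α) (hv : Continuous v)
    (hs : ∀ α, Measurable (s α)) (hsc : ∀ x, Continuous fun α => s α x) (k : ℕ) (r : ℝ) :
    Continuous fun α => posteriorMoment vx (v α) (s α) k r := by
  refine continuous_of_dominated
    (bound := fun x => ‖x ^ k‖ * (√(2 * Real.pi * c))⁻¹) (fun α => ?_)
    (fun α => Filter.Eventually.of_forall fun x => ?_)
    ((integrable_pow_gaussianReal k).norm.mul_const _)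
    (Filter.Eventually.of_forall fun x => ?_)
  · exact (integrable_posteriorMoment (hc.trans_le (hcv α)).ne' (hs α) k r).aestronglyMeasurable
  · rw [norm_mul, Real.norm_of_nonneg (gaussianPDFReal_nonneg _ _ _)]
    gcongr
    exact gaussianPDFReal_le_inv_sqrt hc (hcv α) _ _
  · have h0 : ∀ α, (v α : ℝ) ≠ 0 := fun α => by exact_mod_cast (hc.trans_le (hcv α)).ne'
    have hv' : Continuous fun α => (v α : ℝ) := by fun_prop
    have hx := hsc x
    refine continuous_const.mul ?_
    unfold gaussianPDFReal
    refine Continuous.mul (Continuous.inv₀ (by fun_prop) fun α => ?_) ?_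
    · have : (0 : ℝ) < v α := lt_of_le_of_ne (v α).2 (h0 α).symm
      positivity
    · exact Real.continuous_exp.comp (Continuous.div (by fun_prop) (by fun_prop)
        fun α => mul_ne_zero two_ne_zero (h0 α))

lemma continuous_posteriorSpread (hc : 0 < c) (hcv : ∀ α, c ≤ v α) (hv : Continuous v)
    (hs : ∀ α, Measurable (s α)) (hsc : ∀ x, Continuous fun α => s α x) (r : ℝ) :
    Continuous fun α => posteriorSpread vx (v α) (s α) r :=
  (continuous_posteriorMoment hc hcv hv hs hsc 2 r).sub
    (((continuous_posteriorMoment hc hcv hv hs hsc 1 r).pow 2).div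
      (continuous_posteriorMoment hc hcv hv hs hsc 0 r)
      fun α => (posteriorMoment_zero_pos (hc.trans_le (hcv α)).ne' (hs α) r).ne')

/-- For each output `r` the integrand is continuous in the parameter, and Fatou's lemma integrates
this. No domination in `r` is needed, so signals of infinite power are covered. -/
lemma lowerSemicontinuous_lintegral_posteriorSpread (hc : 0 < c) (hcv : ∀ α, c ≤ v α)
    (hv : Continuous v) (hs : ∀ α, Measurable (s α)) (hsc : ∀ x, Continuous fun α => s α x) :
    LowerSemicontinuous fun α => ∫⁻ r, ENNReal.ofReal (posteriorSpread vx (v α) (s α) r) := by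
  rw [lowerSemicontinuous_iff_le_liminf]
  intro α
  refine le_trans (le_of_eq ?_) (lintegral_liminf_le fun β =>
    (measurable_posteriorSpread (hs β)).ennreal_ofReal)
  refine lintegral_congr fun r => ?_
  exact (Filter.Tendsto.liminf_eq ((ENNReal.continuous_ofReal.comp
    (continuous_posteriorSpread hc hcv hv hs hsc r)).tendsto α)).symm

/-- For a signal and a noise level that depend continuously on a parameter, some pair of a
parameter and an estimator attains the smallest mean square error. -/
theorem exists_channelError_le (hc : 0 < c) (hcv : ∀ α, c ≤ v α)
    (hv : Continuous v) (hs : ∀ α, Measurable (s α)) (hsc : ∀ x, Continuous fun α => s α x)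
    {I : Set ℝ} (hI : IsCompact I) (hne : I.Nonempty) :
    ∃ α ∈ I, ∃ g : ℝ → ℝ, Measurable g ∧ ∀ β ∈ I, ∀ h : ℝ → ℝ, Measurable h →
      channelError vx (v α) (s α) g ≤ channelError vx (v β) (s β) h := by
  obtain ⟨α, hα, hmin⟩ := LowerSemicontinuousOn.exists_isMinOn hne hI
    ((lowerSemicontinuous_lintegral_posteriorSpread (vx := vx) hc hcv hv hs
      hsc).lowerSemicontinuousOn I)
  have hne : ∀ β, v β ≠ 0 := fun β => (hc.trans_le (hcv β)).ne'
  refine ⟨α, hα, posteriorMean vx (v α) (s α), measurable_posteriorMean (hs α),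
    fun β hβ h hh => ?_⟩
  rw [channelError_posteriorMean (hne α) (hs α)]
  exact (hmin hβ).trans (lintegral_posteriorSpread_le (hne β) (hs β) hh)

end Continuity

/-! ### Reduction of the game to a Gaussian channel -/

/-- The variance of the combined noise `α * v + (1 - α) * w`. -/
def noiseVar (σv σw α : ℝ) : ℝ≥0 := Real.toNNReal (α ^ 2 * σv ^ 2 + (1 - α) ^ 2 * σw ^ 2)

/-- The noiseless part of the decoder input, as a function of the source. -/
def combinedSignal (γ : Encoder) (α x : ℝ) : ℝ := α * γ.message x + (1 - α) * x

lemma coe_noiseVar (σv σw α : ℝ) :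
    (noiseVar σv σw α : ℝ) = α ^ 2 * σv ^ 2 + (1 - α) ^ 2 * σw ^ 2 :=
  Real.coe_toNNReal _ (by positivity)

/-- The left side is the minimum over all real `α`: after clearing the denominator, the difference
is the square in the hint. -/
lemma noiseVar_lower_bound {σv σw : ℝ} (hσv : 0 < σv) (hσw : 0 < σw) (α : ℝ) :
    σv ^ 2 * σw ^ 2 / (σv ^ 2 + σw ^ 2) ≤ α ^ 2 * σv ^ 2 + (1 - α) ^ 2 * σw ^ 2 := by
  rw [div_le_iff₀ (by positivity)]
  nlinarith [sq_nonneg (α * σv ^ 2 - (1 - α) * σw ^ 2)]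

lemma noiseVar_real_pos {σv σw : ℝ} (hσv : 0 < σv) (hσw : 0 < σw) (α : ℝ) :
    0 < α ^ 2 * σv ^ 2 + (1 - α) ^ 2 * σw ^ 2 :=
  lt_of_lt_of_le (by positivity) (noiseVar_lower_bound hσv hσw α)

lemma noiseVar_ne_zero {σv σw : ℝ} (hσv : 0 < σv) (hσw : 0 < σw) (α : ℝ) :
    noiseVar σv σw α ≠ 0 := by
  rw [noiseVar, Ne, Real.toNNReal_eq_zero, not_le]
  exact noiseVar_real_pos hσv hσw α

lemma continuous_noiseVar (σv σw : ℝ) : Continuous (noiseVar σv σw) := by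
  unfold noiseVar
  fun_prop

lemma measurable_combinedSignal (γ : Encoder) (α : ℝ) : Measurable (combinedSignal γ α) :=
  (γ.measurable_message.const_mul α).add (measurable_const_mul (1 - α))

lemma continuous_combinedSignal (γ : Encoder) (x : ℝ) :
    Continuous fun α => combinedSignal γ α x := by
  unfold combinedSignal
  fun_prop

lemma received_eq {Ω : Type*} {X V W : Ω → ℝ} (γ : Encoder) (α : ℝ) (ω : Ω) :
    received X V W γ α ω = combinedSignal γ α (X ω) + (α * V ω + (1 - α) * W ω) := by
  rw [received, combinedSignal]
  ring

/-! ### The costs of the game as errors over the combined channel -/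

section Game

variable {Ω : Type*} [MeasurableSpace Ω] {P : Measure Ω}
  {X V W : Ω → ℝ} {σx σv σw b θ : ℝ}

lemma lintegral_ofReal_sq_source (hX : HasLaw X (gaussianReal 0 (Real.toNNReal (σx ^ 2))) P) :
    ∫⁻ ω, ENNReal.ofReal (X ω ^ 2) ∂P = ENNReal.ofReal (σx ^ 2) := by
  rw [hX.lintegral_comp (f := fun x => ENNReal.ofReal (x ^ 2)) (by fun_prop),
    ← ofReal_integral_eq_lintegral_ofReal (integrable_sq_gaussianReal _)
    (Filter.Eventually.of_forall fun x => sq_nonneg _), integral_sq_gaussianReal,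
    Real.coe_toNNReal _ (sq_nonneg σx)]

lemma IsBestResponse.decoderCost_ne_top {γ : Encoder} {d : Decoder}
    (hd : IsBestResponse P X V W γ d)
    (hX : HasLaw X (gaussianReal 0 (Real.toNNReal (σx ^ 2))) P) :
    decoderCost P X V W γ d ≠ ∞ := by
  -- The zero estimator already has finite cost, the variance of the source, however large the
  -- message is.
  have h := hd ⟨0, by simp, fun _ => 0, measurable_const⟩
  refine ne_top_of_le_ne_top ?_ h
  simp only [decoderCost, reconstruction, sub_zero]
  rw [lintegral_ofReal_sq_source hX]
  exact ENNReal.ofReal_ne_top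

lemma aemeasurable_reconstruction (hX : AEMeasurable X P) (hV : AEMeasurable V P)
    (hW : AEMeasurable W P) (γ : Encoder) (d : Decoder) :
    AEMeasurable (reconstruction X V W γ d) P :=
  d.measurable_estimate.comp_aemeasurable
    ((((γ.measurable_message.comp_aemeasurable hX).add hV).const_mul _).add
      ((hX.add hW).const_mul _))

variable [IsProbabilityMeasure P]

/-- The source and the combined noise are independent centred Gaussian variables. -/
lemma hasLaw_source_noise
    (hX : HasLaw X (gaussianReal 0 (Real.toNNReal (σx ^ 2))) P)
    (hV : HasLaw V (gaussianReal 0 (Real.toNNReal (σv ^ 2))) P)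
    (hW : HasLaw W (gaussianReal 0 (Real.toNNReal (σw ^ 2))) P)
    (hindep : iIndepFun ![X, V, W] P) (α : ℝ) :
    HasLaw (fun ω => (X ω, α * V ω + (1 - α) * W ω))
      ((gaussianReal 0 (Real.toNNReal (σx ^ 2))).prod (gaussianReal 0 (noiseVar σv σw α))) P := by
  have hVW : IndepFun V W P := hindep.indepFun (i := 1) (j := 2) (by decide)
  have hVWX : IndepFun (fun ω => (V ω, W ω)) X P := by
    refine hindep.indepFun_prodMk₀ (fun i => ?_) 1 2 0 (by decide) (by decide)
    fin_cases i
    exacts [hX.aemeasurable, hV.aemeasurable, hW.aemeasurable]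
  have hXn : IndepFun X (fun ω => α * V ω + (1 - α) * W ω) P :=
    hVWX.symm.comp (φ := id) (ψ := fun z : ℝ × ℝ => α * z.1 + (1 - α) * z.2) measurable_id
      (by fun_prop)
  have hn : HasLaw (fun ω => α * V ω + (1 - α) * W ω) (gaussianReal 0 (noiseVar σv σw α)) P := by
    refine ⟨(hV.aemeasurable.const_mul α).add (hW.aemeasurable.const_mul (1 - α)), ?_⟩
    have hi : IndepFun (fun ω => α * V ω) (fun ω => (1 - α) * W ω) P :=
      hVW.comp (φ := fun v => α * v) (ψ := fun w => (1 - α) * w) (by fun_prop) (by fun_prop)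
    have h := gaussianReal_add_gaussianReal_of_indepFun hi
      (gaussianReal_const_mul hV α).map_eq (gaussianReal_const_mul hW (1 - α)).map_eq
    refine h.trans ?_
    congr 1
    · simp
    · refine NNReal.coe_injective ?_
      rw [coe_noiseVar]
      simp [Real.coe_toNNReal _ (sq_nonneg σv), Real.coe_toNNReal _ (sq_nonneg σw)]
  exact (indepFun_iff_hasLaw_prodMk_prod hX hn).1 hXn

lemma decoderCost_eq_channelError
    (hX : HasLaw X (gaussianReal 0 (Real.toNNReal (σx ^ 2))) P)
    (hV : HasLaw V (gaussianReal 0 (Real.toNNReal (σv ^ 2))) P)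
    (hW : HasLaw W (gaussianReal 0 (Real.toNNReal (σw ^ 2))) P)
    (hindep : iIndepFun ![X, V, W] P) (γ : Encoder) (d : Decoder) :
    decoderCost P X V W γ d = channelError (Real.toNNReal (σx ^ 2)) (noiseVar σv σw d.ratio)
      (combinedSignal γ d.ratio) d.estimate := by
  have h := hasLaw_source_noise hX hV hW hindep d.ratio
  have hd := d.measurable_estimate
  have hs := measurable_combinedSignal γ d.ratio
  have hm : Measurable fun z : ℝ × ℝ => ENNReal.ofReal
      ((z.1 - d.estimate (combinedSignal γ d.ratio z.1 + z.2)) ^ 2) := by fun_prop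
  rw [channelError, ← h.lintegral_comp hm.aemeasurable]
  simp only [decoderCost, reconstruction, received_eq]

/-- Every encoder strategy has an optimal reaction. -/
lemma exists_isBestResponse (hσv : 0 < σv) (hσw : 0 < σw)
    (hX : HasLaw X (gaussianReal 0 (Real.toNNReal (σx ^ 2))) P)
    (hV : HasLaw V (gaussianReal 0 (Real.toNNReal (σv ^ 2))) P)
    (hW : HasLaw W (gaussianReal 0 (Real.toNNReal (σw ^ 2))) P)
    (hindep : iIndepFun ![X, V, W] P) (γ : Encoder) :
    ∃ d : Decoder, IsBestResponse P X V W γ d := by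
  obtain ⟨α, hα, g, hg, hmin⟩ := exists_channelError_le (vx := Real.toNNReal (σx ^ 2))
    (c := Real.toNNReal (σv ^ 2 * σw ^ 2 / (σv ^ 2 + σw ^ 2)))
    (Real.toNNReal_pos.2 (by positivity))
    (fun α => Real.toNNReal_le_toNNReal (noiseVar_lower_bound hσv hσw α))
    (continuous_noiseVar σv σw) (measurable_combinedSignal γ) (continuous_combinedSignal γ)
    (isCompact_Icc (a := (0 : ℝ)) (b := 1)) ⟨0, by simp⟩
  refine ⟨⟨α, hα, g, hg⟩, fun d' => ?_⟩
  rw [decoderCost_eq_channelError hX hV hW hindep, decoderCost_eq_channelError hX hV hW hindep]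
  exact hmin d'.ratio d'.ratio_mem d'.estimate d'.measurable_estimate

/-- An optimal reaction is unbiased, so that under it the bias of the encoder merely adds a
constant to its cost. -/
lemma IsBestResponse.encoderCost_eq (hθ : 0 ≤ θ) {γ : Encoder} {d : Decoder}
    (hd : IsBestResponse P X V W γ d)
    (hX : HasLaw X (gaussianReal 0 (Real.toNNReal (σx ^ 2))) P)
    (hV : AEMeasurable V P) (hW : AEMeasurable W P) :
    encoderCost P X V W b θ γ d = decoderCost P X V W γ d + ENNReal.ofReal (b ^ 2) +
      ∫⁻ x, ENNReal.ofReal (θ * γ.message x ^ 2)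
        ∂(gaussianReal 0 (Real.toNNReal (σx ^ 2))) := by
  set e : Ω → ℝ := fun ω => X ω - reconstruction X V W γ d ω
  have hem : AEMeasurable e P :=
    hX.aemeasurable.sub (aemeasurable_reconstruction hX.aemeasurable hV hW γ d)
  have hfin := hd.decoderCost_ne_top hX
  have he2 : Integrable (fun ω => e ω ^ 2) P :=
    (lintegral_ofReal_ne_top_iff_integrable (hem.pow_const 2).aestronglyMeasurable
      (Filter.Eventually.of_forall fun ω => sq_nonneg _)).1 hfin
  have he : Integrable e P :=
    ((memLp_two_iff_integrable_sq hem.aestronglyMeasurable).2 he2).integrable one_le_two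
  have hshift : ∀ c : ℝ, Integrable (fun ω => (e ω - c) ^ 2) P ∧
      ∫ ω, (e ω - c) ^ 2 ∂P = ∫ ω, e ω ^ 2 ∂P - 2 * c * ∫ ω, e ω ∂P + c ^ 2 := by
    intro c
    have heq : ∀ ω, (e ω - c) ^ 2 = e ω ^ 2 - 2 * c * e ω + c ^ 2 := fun ω => by ring
    have h1 : Integrable (fun ω => e ω ^ 2 - 2 * c * e ω) P := he2.sub (he.const_mul _)
    simp_rw [heq]
    refine ⟨h1.add (integrable_const _), ?_⟩
    rw [integral_add h1 (integrable_const _), integral_sub he2 (he.const_mul _),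
      integral_const_mul]
    simp
  have hcost : decoderCost P X V W γ d = ENNReal.ofReal (∫ ω, e ω ^ 2 ∂P) :=
    (ofReal_integral_eq_lintegral_ofReal he2
      (Filter.Eventually.of_forall fun ω => sq_nonneg _)).symm
  have hmean : ∫ ω, e ω ∂P = 0 := by
    set m := ∫ ω, e ω ∂P
    -- Adding the mean error `m` to the estimate lowers the mean square error by `m²`, so optimality
    -- forces `m = 0`.
    have h := hd ⟨d.ratio, d.ratio_mem, fun r => d.estimate r + m,
      d.measurable_estimate.add_const m⟩
    have hc : decoderCost P X V W γ ⟨d.ratio, d.ratio_mem, fun r => d.estimate r + m,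
        d.measurable_estimate.add_const m⟩ = ENNReal.ofReal (∫ ω, (e ω - m) ^ 2 ∂P) := by
      rw [ofReal_integral_eq_lintegral_ofReal (hshift m).1
        (Filter.Eventually.of_forall fun ω => sq_nonneg _)]
      refine lintegral_congr fun ω => ?_
      simp only [reconstruction, e]
      ring_nf
    rw [hcost, hc, ENNReal.ofReal_le_ofReal_iff (integral_nonneg fun ω => sq_nonneg _),
      (hshift m).2] at h
    change _ ≤ _ - 2 * m * m + _ at h
    nlinarith [sq_nonneg m]
  have hb : ∫⁻ ω, ENNReal.ofReal ((e ω - b) ^ 2) ∂P =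
      decoderCost P X V W γ d + ENNReal.ofReal (b ^ 2) := by
    rw [← ofReal_integral_eq_lintegral_ofReal (hshift b).1
      (Filter.Eventually.of_forall fun ω => sq_nonneg _), (hshift b).2, hmean, hcost,
      mul_zero, sub_zero, ENNReal.ofReal_add (integral_nonneg fun ω => sq_nonneg _)
      (sq_nonneg b)]
  have hγ := γ.measurable_message
  rw [← hb, ← hX.lintegral_comp (f := fun x => ENNReal.ofReal (θ * γ.message x ^ 2))
    (by fun_prop), ← lintegral_add_left' (by fun_prop)]
  refine lintegral_congr fun ω => ?_
  rw [ENNReal.ofReal_add (sq_nonneg _) (mul_nonneg hθ (sq_nonneg _))]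

end Game

/-! ### Second moments of the encoder -/

section Power

variable {vx : ℝ≥0}

lemma memLp_combinedSignal {γ : Encoder} (hγ : MemLp γ.message 2 (gaussianReal 0 vx)) (α : ℝ) :
    MemLp (combinedSignal γ α) 2 (gaussianReal 0 vx) :=
  (hγ.const_mul α).add ((memLp_id_gaussianReal 2).const_mul (1 - α))

lemma integrable_message_mul_id {γ : Encoder} (hγ : MemLp γ.message 2 (gaussianReal 0 vx)) :
    Integrable (fun x => γ.message x * x) (gaussianReal 0 vx) :=
  hγ.integrable_mul (q := 2) (memLp_id_gaussianReal 2)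

lemma integrable_sq_lincomb {γ : Encoder} (hγ : MemLp γ.message 2 (gaussianReal 0 vx))
    (c k : ℝ) :
    Integrable (fun x => (c * γ.message x + k * x) ^ 2) (gaussianReal 0 vx) :=
  ((hγ.const_mul c).add ((memLp_id_gaussianReal 2).const_mul k)).integrable_sq

lemma integral_sq_lincomb {γ : Encoder} (hγ : MemLp γ.message 2 (gaussianReal 0 vx)) (c k : ℝ) :
    ∫ x, (c * γ.message x + k * x) ^ 2 ∂(gaussianReal 0 vx) =
      c ^ 2 * ∫ x, γ.message x ^ 2 ∂(gaussianReal 0 vx) +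
        2 * c * k * ∫ x, γ.message x * x ∂(gaussianReal 0 vx) + k ^ 2 * vx := by
  have e : ∀ x, (c * γ.message x + k * x) ^ 2 =
      c ^ 2 * γ.message x ^ 2 + 2 * c * k * (γ.message x * x) + k ^ 2 * x ^ 2 := fun x => by ring
  have i1 := hγ.integrable_sq.const_mul (c ^ 2)
  have i2 := (integrable_message_mul_id hγ).const_mul (2 * c * k)
  have i3 := (integrable_sq_gaussianReal vx).const_mul (k ^ 2)
  have i12 : Integrable (fun x => c ^ 2 * γ.message x ^ 2 + 2 * c * k * (γ.message x * x))
      (gaussianReal 0 vx) := i1.add i2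
  simp_rw [e]
  rw [integral_add i12 i3, integral_add i1 i2, integral_const_mul, integral_const_mul,
    integral_const_mul, integral_sq_gaussianReal]

/-- The Cauchy-Schwarz inequality for the correlation of the message and the source. -/
lemma integral_message_mul_id_le {γ : Encoder} (hvx : vx ≠ 0)
    (hγ : MemLp γ.message 2 (gaussianReal 0 vx)) {a : ℝ} (ha : 0 ≤ a)
    (hp : ∫ x, γ.message x ^ 2 ∂(gaussianReal 0 vx) = a ^ 2 * vx) :
    ∫ x, γ.message x * x ∂(gaussianReal 0 vx) ≤ a * vx := by
  set u := ∫ x, γ.message x * x ∂(gaussianReal 0 vx)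
  have hvx' : (0 : ℝ) < vx := by exact_mod_cast pos_iff_ne_zero.2 hvx
  -- This is the residual of regressing the message on the source, scaled by `vx` to avoid a
  -- division.
  have h : 0 ≤ ∫ x, ((vx : ℝ) * γ.message x + (-u) * x) ^ 2 ∂(gaussianReal 0 vx) :=
    integral_nonneg fun x => sq_nonneg _
  rw [integral_sq_lincomb hγ, hp] at h
  have h' : 0 ≤ vx * ((a * vx) ^ 2 - u ^ 2) := by
    change 0 ≤ _ + 2 * _ * _ * u + _ at h
    linarith
  have := nonneg_of_mul_nonneg_right h' hvx'
  exact le_trans (le_abs_self u) (abs_le_of_sq_le_sq (by linarith) (by positivity))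

/-- The error of a linear estimator of the source from a linear signal. -/
lemma channelError_linear (vx vn : ℝ≥0) (k c : ℝ) :
    channelError vx vn (fun x => k * x) (fun r => c * r) =
      ENNReal.ofReal ((1 - c * k) ^ 2 * vx + c ^ 2 * vn) := by
  set M := (gaussianReal 0 vx).prod (gaussianReal 0 vn)
  have e : ∀ z : ℝ × ℝ, (z.1 - c * (k * z.1 + z.2)) ^ 2 =
      (1 - c * k) ^ 2 * z.1 ^ 2 + (-2 * (1 - c * k) * c) * (z.1 * z.2) + c ^ 2 * z.2 ^ 2 :=
    fun z => by ring
  have i1 : Integrable (fun z : ℝ × ℝ => (1 - c * k) ^ 2 * z.1 ^ 2) M :=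
    integrable_channel_fst_sq.const_mul _
  have i2 : Integrable (fun z : ℝ × ℝ => (-2 * (1 - c * k) * c) * (z.1 * z.2)) M :=
    ((integrable_id_gaussianReal vx).mul_prod (integrable_id_gaussianReal vn)).const_mul _
  have i3 : Integrable (fun z : ℝ × ℝ => c ^ 2 * z.2 ^ 2) M :=
    integrable_channel_snd_sq.const_mul _
  have i12 : Integrable (fun z : ℝ × ℝ => (1 - c * k) ^ 2 * z.1 ^ 2 +
      (-2 * (1 - c * k) * c) * (z.1 * z.2)) M := i1.add i2
  have i : Integrable (fun z : ℝ × ℝ => (z.1 - c * (k * z.1 + z.2)) ^ 2) M := by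
    simp_rw [e]; exact i12.add i3
  rw [channelError, ← ofReal_integral_eq_lintegral_ofReal i
    (Filter.Eventually.of_forall fun z => sq_nonneg _)]
  congr 1
  simp_rw [e]
  have h3 := integral_prod_mul (μ := gaussianReal 0 vx) (ν := gaussianReal 0 vn)
    (fun x : ℝ => x) (fun n => n)
  rw [integral_add i12 i3, integral_add i1 i2, integral_const_mul, integral_const_mul,
    integral_const_mul, integral_channel_fst_sq, integral_channel_snd_sq, h3]
  simp

end Power

/-! ### The optimal trade-off between distortion and power -/

/-- The least mean square error of the source that is attainable when the encoder uses the power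
`q * σx ^ 2`. -/
def minError (σx σv σw q : ℝ) : ℝ := σx ^ 2 / (1 + σx ^ 2 / σw ^ 2 + q * (σx ^ 2 / σv ^ 2))

section Tradeoff

variable {σx σv σw θ : ℝ}

lemma minError_nonneg {q : ℝ} (hq : 0 ≤ q) : 0 ≤ minError σx σv σw q := by
  unfold minError
  positivity

/-- The signal to noise ratio of the combined observation falls short of its largest value by a
sum of two nonnegative terms. -/
lemma snr_gap (hσv : 0 < σv) (hσw : 0 < σw) (a u α : ℝ) :
    (α ^ 2 * σv ^ 2 + (1 - α) ^ 2 * σw ^ 2) * (σx ^ 2 / σw ^ 2 + a ^ 2 * (σx ^ 2 / σv ^ 2)) -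
      (α ^ 2 * (a ^ 2 * σx ^ 2) + 2 * α * (1 - α) * u + (1 - α) ^ 2 * σx ^ 2) =
    σx ^ 2 / (σv ^ 2 * σw ^ 2) * (α * σv ^ 2 - (1 - α) * a * σw ^ 2) ^ 2 +
      2 * (α * (1 - α) * (a * σx ^ 2 - u)) := by
  field_simp
  ring

/-- The error `σx² N / (S + N)` decreases in `S / N`, and `minError` is its value at the largest
possible ratio. -/
lemma minError_le_of_gap_nonneg {q N S : ℝ} (hσx : 0 < σx) (hq : 0 ≤ q) (hN : 0 < N)
    (hS : 0 ≤ S) (hgap : 0 ≤ N * (σx ^ 2 / σw ^ 2 + q * (σx ^ 2 / σv ^ 2)) - S) :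
    minError σx σv σw q ≤ σx ^ 2 * N / (S + N) := by
  rw [minError, div_le_div_iff₀ (by positivity) (by positivity), mul_assoc]
  gcongr
  linarith

lemma gap_nonpos_of_le_minError {q N S : ℝ} (hσx : 0 < σx) (hq : 0 ≤ q) (hN : 0 < N)
    (hS : 0 ≤ S) (h : σx ^ 2 * N / (S + N) ≤ minError σx σv σw q) :
    N * (σx ^ 2 / σw ^ 2 + q * (σx ^ 2 / σv ^ 2)) - S ≤ 0 := by
  rw [minError, div_le_div_iff₀ (by positivity) (by positivity), mul_assoc] at h
  have := le_of_mul_le_mul_left h (by positivity)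
  linarith

/-- The difference is split into its tangent-line term at `q₀` and the remainder of a convex
function, a positive multiple of `(q - q₀)²` when `σx` is nonzero. -/
lemma tradeoff_sub (hσv : 0 < σv) {q q₀ : ℝ} (hq : 0 ≤ q) (hq₀ : 0 ≤ q₀) :
    (minError σx σv σw q + θ * q * σx ^ 2) - (minError σx σv σw q₀ + θ * q₀ * σx ^ 2) =
      σx ^ 2 / (σv ^ 2 * (1 + σx ^ 2 / σw ^ 2 + q * (σx ^ 2 / σv ^ 2)) *
        (1 + σx ^ 2 / σw ^ 2 + q₀ * (σx ^ 2 / σv ^ 2)) ^ 2) *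
      ((1 + σx ^ 2 / σw ^ 2 + q * (σx ^ 2 / σv ^ 2)) * ((q - q₀) *
        (θ * σv ^ 2 * (1 + σx ^ 2 / σw ^ 2 + q₀ * (σx ^ 2 / σv ^ 2)) ^ 2 - σx ^ 2)) +
        σx ^ 2 * (σx ^ 2 / σv ^ 2) * (q - q₀) ^ 2) := by
  obtain ⟨k, hk⟩ : ∃ k, k = σx ^ 2 / σv ^ 2 := ⟨_, rfl⟩
  obtain ⟨m, hm⟩ : ∃ m, m = 1 + σx ^ 2 / σw ^ 2 := ⟨_, rfl⟩
  have hk0 : 0 ≤ k := by rw [hk]; positivity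
  have hm0 : 0 < m := by rw [hm]; positivity
  have hx : σx ^ 2 = k * σv ^ 2 := by rw [hk]; field_simp
  have hD : 0 < m + q * k := by positivity
  have hD₀ : 0 < m + q₀ * k := by positivity
  rw [minError, minError, ← hm, ← hk, hx]
  field_simp
  ring

variable {q₀ : ℝ}

/-- The first-order condition for the power `q₀ * σx ^ 2` to be optimal. -/
def IsStationary (σx σv σw θ q₀ : ℝ) : Prop :=
  ∀ q, 0 ≤ q → 0 ≤ (q - q₀) *
    (θ * σv ^ 2 * (1 + σx ^ 2 / σw ^ 2 + q₀ * (σx ^ 2 / σv ^ 2)) ^ 2 - σx ^ 2)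

lemma IsStationary.tradeoff_le (h : IsStationary σx σv σw θ q₀) (hσv : 0 < σv) (hq₀ : 0 ≤ q₀)
    {q : ℝ} (hq : 0 ≤ q) :
    minError σx σv σw q₀ + θ * q₀ * σx ^ 2 ≤ minError σx σv σw q + θ * q * σx ^ 2 := by
  have h1 := h q hq
  rw [← sub_nonneg, tradeoff_sub hσv hq hq₀]
  positivity

lemma IsStationary.eq_of_tradeoff_le (h : IsStationary σx σv σw θ q₀) (hσx : 0 < σx)
    (hσv : 0 < σv) (hq₀ : 0 ≤ q₀) {q : ℝ} (hq : 0 ≤ q)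
    (hle : minError σx σv σw q + θ * q * σx ^ 2 ≤ minError σx σv σw q₀ + θ * q₀ * σx ^ 2) :
    q = q₀ := by
  have h1 := h q hq
  by_contra hne
  have h2 : 0 < (q - q₀) ^ 2 := sq_pos_of_ne_zero (sub_ne_zero.2 hne)
  rw [← sub_nonpos, tradeoff_sub hσv hq hq₀] at hle
  refine absurd hle (not_le.2 (mul_pos (by positivity) ?_))
  exact add_pos_of_nonneg_of_pos (mul_nonneg (by positivity) h1) (by positivity)

/-- The square of the gain of the equilibrium encoder. -/
def optimalGainSq (σx σv σw θ : ℝ) : ℝ :=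
  if θ < σx ^ 2 / (σv ^ 2 * (σx ^ 2 / σw ^ 2 + 1) ^ 2) then
    √(σv ^ 2 / (θ * σx ^ 2)) - σv ^ 2 / σx ^ 2 * (σx ^ 2 / σw ^ 2 + 1)
  else 0

lemma optimalGainSq_pos_iff (hσx : 0 < σx) (hσv : 0 < σv) (hθ : 0 < θ) :
    0 < optimalGainSq σx σv σw θ ↔ θ < σx ^ 2 / (σv ^ 2 * (σx ^ 2 / σw ^ 2 + 1) ^ 2) := by
  unfold optimalGainSq
  split_ifs with h
  · refine iff_of_true (sub_pos.2 (Real.lt_sqrt_of_sq_lt ?_)) h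
    rw [lt_div_iff₀ (by positivity)] at h ⊢
    have e : (σv ^ 2 / σx ^ 2 * (σx ^ 2 / σw ^ 2 + 1)) ^ 2 * (θ * σx ^ 2) =
        σv ^ 2 / σx ^ 2 * (θ * (σv ^ 2 * (σx ^ 2 / σw ^ 2 + 1) ^ 2)) := by
      field_simp
    rw [e]
    calc _ < σv ^ 2 / σx ^ 2 * σx ^ 2 := by gcongr
      _ = σv ^ 2 := by field_simp
  · simp [h]

lemma optimalGainSq_nonneg (hσx : 0 < σx) (hσv : 0 < σv) (hθ : 0 < θ) :
    0 ≤ optimalGainSq σx σv σw θ := by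
  by_cases h : θ < σx ^ 2 / (σv ^ 2 * (σx ^ 2 / σw ^ 2 + 1) ^ 2)
  · exact ((optimalGainSq_pos_iff hσx hσv hθ).2 h).le
  · simp [optimalGainSq, h]

lemma isStationary_optimalGainSq (hσx : 0 < σx) (hσv : 0 < σv) (hθ : 0 < θ) :
    IsStationary σx σv σw θ (optimalGainSq σx σv σw θ) := by
  intro q hq
  -- Below the threshold the derivative vanishes at the optimum; otherwise the optimum is the
  -- endpoint `0`, where the derivative is nonnegative.
  by_cases h : θ < σx ^ 2 / (σv ^ 2 * (σx ^ 2 / σw ^ 2 + 1) ^ 2)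
  · have e : 1 + σx ^ 2 / σw ^ 2 + optimalGainSq σx σv σw θ * (σx ^ 2 / σv ^ 2) =
        √(σv ^ 2 / (θ * σx ^ 2)) * (σx ^ 2 / σv ^ 2) := by
      have : σv ^ 2 / σx ^ 2 * (σx ^ 2 / σv ^ 2) = 1 := by field_simp
      simp only [optimalGainSq, h, if_true]
      linear_combination (-(σx ^ 2 / σw ^ 2 + 1)) * this
    have e2 : θ * σv ^ 2 * (√(σv ^ 2 / (θ * σx ^ 2)) * (σx ^ 2 / σv ^ 2)) ^ 2 - σx ^ 2 = 0 := by
      rw [mul_pow, Real.sq_sqrt (by positivity)]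
      field_simp
      ring
    rw [e, e2, mul_zero]
  · have e : optimalGainSq σx σv σw θ = 0 := by simp [optimalGainSq, h]
    rw [e, zero_mul, add_zero, sub_zero]
    rw [not_lt, div_le_iff₀ (by positivity)] at h
    exact mul_nonneg hq (by linarith)

end Tradeoff

/-! ### Lower bounds on the decoder cost -/

section Bounds

variable {Ω : Type*} [MeasurableSpace Ω] {P : Measure Ω} [IsProbabilityMeasure P]
  {X V W : Ω → ℝ} {σx σv σw b θ : ℝ}

lemma toNNReal_sq_ne_zero {σ : ℝ} (hσ : 0 < σ) : Real.toNNReal (σ ^ 2) ≠ 0 := by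
  rw [Ne, Real.toNNReal_eq_zero, not_le]
  positivity

lemma integral_sq_combinedSignal {γ : Encoder}
    (hγ : MemLp γ.message 2 (gaussianReal 0 (Real.toNNReal (σx ^ 2)))) {a : ℝ}
    (hp : ∫ x, γ.message x ^ 2 ∂(gaussianReal 0 (Real.toNNReal (σx ^ 2))) = a ^ 2 * σx ^ 2)
    (α : ℝ) :
    ∫ x, combinedSignal γ α x ^ 2 ∂(gaussianReal 0 (Real.toNNReal (σx ^ 2))) =
      α ^ 2 * (a ^ 2 * σx ^ 2) + 2 * α * (1 - α) *
        ∫ x, γ.message x * x ∂(gaussianReal 0 (Real.toNNReal (σx ^ 2))) +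
        (1 - α) ^ 2 * σx ^ 2 := by
  simp only [combinedSignal]
  rw [integral_sq_lincomb hγ, hp, Real.coe_toNNReal _ (sq_nonneg σx)]

lemma decoderCost_ge_snr (hσx : 0 < σx) (hσv : 0 < σv) (hσw : 0 < σw)
    (hX : HasLaw X (gaussianReal 0 (Real.toNNReal (σx ^ 2))) P)
    (hV : HasLaw V (gaussianReal 0 (Real.toNNReal (σv ^ 2))) P)
    (hW : HasLaw W (gaussianReal 0 (Real.toNNReal (σw ^ 2))) P)
    (hindep : iIndepFun ![X, V, W] P) {γ : Encoder}
    (hγ : MemLp γ.message 2 (gaussianReal 0 (Real.toNNReal (σx ^ 2)))) (d : Decoder) :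
    ENNReal.ofReal (σx ^ 2 * (d.ratio ^ 2 * σv ^ 2 + (1 - d.ratio) ^ 2 * σw ^ 2) /
      (∫ x, combinedSignal γ d.ratio x ^ 2 ∂(gaussianReal 0 (Real.toNNReal (σx ^ 2))) +
        (d.ratio ^ 2 * σv ^ 2 + (1 - d.ratio) ^ 2 * σw ^ 2))) ≤ decoderCost P X V W γ d := by
  have h := channelError_ge (toNNReal_sq_ne_zero hσx) (noiseVar_ne_zero hσv hσw d.ratio)
    (measurable_combinedSignal γ d.ratio) (memLp_combinedSignal hγ d.ratio) d.measurable_estimate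
  rwa [Real.coe_toNNReal _ (sq_nonneg σx), coe_noiseVar,
    ← decoderCost_eq_channelError hX hV hW hindep] at h

lemma snr_gap_terms_nonneg (hσx : 0 < σx) {γ : Encoder}
    (hγ : MemLp γ.message 2 (gaussianReal 0 (Real.toNNReal (σx ^ 2)))) {a : ℝ} (ha : 0 ≤ a)
    (hp : ∫ x, γ.message x ^ 2 ∂(gaussianReal 0 (Real.toNNReal (σx ^ 2))) = a ^ 2 * σx ^ 2)
    {α : ℝ} (hα : α ∈ Set.Icc (0 : ℝ) 1) :
    0 ≤ α * (1 - α) * (a * σx ^ 2 -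
      ∫ x, γ.message x * x ∂(gaussianReal 0 (Real.toNNReal (σx ^ 2)))) := by
  have hcoe := Real.coe_toNNReal _ (sq_nonneg σx)
  have hu := integral_message_mul_id_le (toNNReal_sq_ne_zero hσx) hγ ha (by rw [hp, hcoe])
  rw [hcoe] at hu
  exact mul_nonneg (mul_nonneg hα.1 (sub_nonneg.2 hα.2)) (sub_nonneg.2 hu)

/-- Whatever the strategies, the decoder cost is at least the cost of the best linear scheme of
the same power. -/
theorem minError_le_decoderCost (hσx : 0 < σx) (hσv : 0 < σv) (hσw : 0 < σw)
    (hX : HasLaw X (gaussianReal 0 (Real.toNNReal (σx ^ 2))) P)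
    (hV : HasLaw V (gaussianReal 0 (Real.toNNReal (σv ^ 2))) P)
    (hW : HasLaw W (gaussianReal 0 (Real.toNNReal (σw ^ 2))) P)
    (hindep : iIndepFun ![X, V, W] P) {γ : Encoder}
    (hγ : MemLp γ.message 2 (gaussianReal 0 (Real.toNNReal (σx ^ 2)))) {a : ℝ} (ha : 0 ≤ a)
    (hp : ∫ x, γ.message x ^ 2 ∂(gaussianReal 0 (Real.toNNReal (σx ^ 2))) = a ^ 2 * σx ^ 2)
    (d : Decoder) :
    ENNReal.ofReal (minError σx σv σw (a ^ 2)) ≤ decoderCost P X V W γ d := by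
  refine le_trans (ENNReal.ofReal_le_ofReal ?_)
    (decoderCost_ge_snr hσx hσv hσw hX hV hW hindep hγ d)
  refine minError_le_of_gap_nonneg hσx (sq_nonneg a) (noiseVar_real_pos hσv hσw _)
    (integral_nonneg fun x => sq_nonneg _) ?_
  have h := snr_gap_terms_nonneg hσx hγ ha hp d.ratio_mem
  rw [integral_sq_combinedSignal hγ hp, snr_gap hσv hσw]
  positivity

/-- Equality in the lower bound on the decoder cost determines the ratio, and makes the message
proportional to the source. -/
theorem eq_of_decoderCost_le_minError (hσx : 0 < σx) (hσv : 0 < σv) (hσw : 0 < σw)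
    (hX : HasLaw X (gaussianReal 0 (Real.toNNReal (σx ^ 2))) P)
    (hV : HasLaw V (gaussianReal 0 (Real.toNNReal (σv ^ 2))) P)
    (hW : HasLaw W (gaussianReal 0 (Real.toNNReal (σw ^ 2))) P)
    (hindep : iIndepFun ![X, V, W] P) {γ : Encoder}
    (hγ : MemLp γ.message 2 (gaussianReal 0 (Real.toNNReal (σx ^ 2)))) {a : ℝ} (ha : 0 ≤ a)
    (hp : ∫ x, γ.message x ^ 2 ∂(gaussianReal 0 (Real.toNNReal (σx ^ 2))) = a ^ 2 * σx ^ 2)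
    {d : Decoder} (hd : decoderCost P X V W γ d ≤ ENNReal.ofReal (minError σx σv σw (a ^ 2))) :
    d.ratio = a * σw ^ 2 / (a * σw ^ 2 + σv ^ 2) ∧
      γ.message =ᵐ[gaussianReal 0 (Real.toNNReal (σx ^ 2))] fun x => a * x := by
  have hle := (decoderCost_ge_snr hσx hσv hσw hX hV hW hindep hγ d).trans hd
  rw [ENNReal.ofReal_le_ofReal_iff (minError_nonneg (sq_nonneg a))] at hle
  have hgap := gap_nonpos_of_le_minError hσx (sq_nonneg a) (noiseVar_real_pos hσv hσw _)
    (integral_nonneg fun x => sq_nonneg _) hle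
  have h := snr_gap_terms_nonneg hσx hγ ha hp d.ratio_mem
  rw [integral_sq_combinedSignal hγ hp, snr_gap hσv hσw] at hgap
  set u := ∫ x, γ.message x * x ∂(gaussianReal 0 (Real.toNNReal (σx ^ 2))) with hu
  set α := d.ratio
  have hc : 0 < σx ^ 2 / (σv ^ 2 * σw ^ 2) := by positivity
  have h0 : 0 ≤ σx ^ 2 / (σv ^ 2 * σw ^ 2) * (α * σv ^ 2 - (1 - α) * a * σw ^ 2) ^ 2 := by
    positivity
  -- Two nonnegative terms with nonpositive sum both vanish: the first fixes the ratio, the second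
  -- gives equality in Cauchy-Schwarz when `0 < α < 1`.
  have h1 : (α * σv ^ 2 - (1 - α) * a * σw ^ 2) ^ 2 = 0 :=
    (mul_eq_zero.1 (le_antisymm (by linarith) h0)).resolve_left hc.ne'
  have h2 : α * (1 - α) * (a * σx ^ 2 - u) = 0 := le_antisymm (by linarith) h
  have h3 : α * σv ^ 2 - (1 - α) * a * σw ^ 2 = 0 := pow_eq_zero_iff two_ne_zero |>.1 h1
  have hα : α = a * σw ^ 2 / (a * σw ^ 2 + σv ^ 2) := by
    rw [eq_div_iff (by positivity)]
    linarith
  refine ⟨hα, ?_⟩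
  -- For `a = 0` the ratio is `0` and the correlation term says nothing about `u`; the factor `a`
  -- covers this case and is all that the next integral needs.
  have hau : a * (a * σx ^ 2 - u) = 0 := by
    rcases ha.eq_or_lt with h | h
    · rw [← h, zero_mul]
    · have hα1 : 1 - α = σv ^ 2 / (a * σw ^ 2 + σv ^ 2) := by
        rw [hα]; field_simp; ring
      have : α * (1 - α) ≠ 0 := by
        rw [hα1, hα]; positivity
      rw [(mul_eq_zero.1 h2).resolve_left this, mul_zero]
  have hint := integral_sq_lincomb hγ 1 (-a)
  have hzero : ∫ x, (1 * γ.message x + (-a) * x) ^ 2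
      ∂(gaussianReal 0 (Real.toNNReal (σx ^ 2))) = 0 := by
    rw [hint, hp, Real.coe_toNNReal _ (sq_nonneg σx), ← hu]
    linear_combination 2 * hau
  rw [integral_eq_zero_iff_of_nonneg (fun x => sq_nonneg _) (integrable_sq_lincomb hγ 1 (-a))]
    at hzero
  filter_upwards [hzero] with x hx
  have := pow_eq_zero_iff two_ne_zero |>.1 hx
  linarith

/-- Needed because an equilibrium message is known to be linear only almost everywhere. -/
lemma channelError_congr {vx vn : ℝ≥0} {s s' : ℝ → ℝ} (h : s =ᵐ[gaussianReal 0 vx] s')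
    (g : ℝ → ℝ) : channelError vx vn s g = channelError vx vn s' g := by
  refine lintegral_congr_ae ?_
  filter_upwards [Measure.quasiMeasurePreserving_fst.ae h] with z hz
  rw [hz]

/-- A best response to an encoder strategy of finite cost, in real terms. -/
lemma IsBestResponse.exists_power (hσx : 0 < σx) (hθ : 0 < θ) {γ : Encoder} {d : Decoder}
    (hd : IsBestResponse P X V W γ d)
    (hX : HasLaw X (gaussianReal 0 (Real.toNNReal (σx ^ 2))) P)
    (hV : AEMeasurable V P) (hW : AEMeasurable W P) (hfin : encoderCost P X V W b θ γ d ≠ ∞) :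
    MemLp γ.message 2 (gaussianReal 0 (Real.toNNReal (σx ^ 2))) ∧ ∃ a D : ℝ, 0 ≤ a ∧ 0 ≤ D ∧
      ∫ x, γ.message x ^ 2 ∂(gaussianReal 0 (Real.toNNReal (σx ^ 2))) = a ^ 2 * σx ^ 2 ∧
      decoderCost P X V W γ d = ENNReal.ofReal D ∧
      encoderCost P X V W b θ γ d = ENNReal.ofReal (D + θ * a ^ 2 * σx ^ 2 + b ^ 2) := by
  have hcost := hd.encoderCost_eq (b := b) hθ.le hX hV hW
  have hm := γ.measurable_message
  have hnn : ∀ x, 0 ≤ θ * γ.message x ^ 2 := fun x => mul_nonneg hθ.le (sq_nonneg _)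
  have hpow : ∫⁻ x, ENNReal.ofReal (θ * γ.message x ^ 2)
      ∂(gaussianReal 0 (Real.toNNReal (σx ^ 2))) ≠ ∞ := fun h => hfin (by rw [hcost, h, add_top])
  have hint : Integrable (fun x => θ * γ.message x ^ 2)
      (gaussianReal 0 (Real.toNNReal (σx ^ 2))) :=
    (lintegral_ofReal_ne_top_iff_integrable (by fun_prop)
      (Filter.Eventually.of_forall hnn)).1 hpow
  have hint' : Integrable (fun x => γ.message x ^ 2)
      (gaussianReal 0 (Real.toNNReal (σx ^ 2))) :=
    (integrable_const_mul_iff hθ.ne'.isUnit _).1 hint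
  have hpnn : 0 ≤ ∫ x, γ.message x ^ 2 ∂(gaussianReal 0 (Real.toNNReal (σx ^ 2))) :=
    integral_nonneg fun x => sq_nonneg _
  have hp : ∫ x, γ.message x ^ 2 ∂(gaussianReal 0 (Real.toNNReal (σx ^ 2))) =
      (√(∫ x, γ.message x ^ 2 ∂(gaussianReal 0 (Real.toNNReal (σx ^ 2)))) / σx) ^ 2 * σx ^ 2 := by
    rw [div_pow, Real.sq_sqrt hpnn]
    field_simp
  have hD := (ENNReal.ofReal_toReal (hd.decoderCost_ne_top hX)).symm
  refine ⟨(memLp_two_iff_integrable_sq hm.aestronglyMeasurable).2 hint', _, _, by positivity,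
    ENNReal.toReal_nonneg, hp, hD, ?_⟩
  rw [mul_assoc θ, ← hp, hcost, ← ofReal_integral_eq_lintegral_ofReal hint
    (Filter.Eventually.of_forall hnn), integral_const_mul,
    ENNReal.ofReal_add (by positivity) (sq_nonneg b),
    ENNReal.ofReal_add ENNReal.toReal_nonneg (by positivity), ← hD]
  ring

end Bounds

/-! ### The linear equilibrium -/

section Linear

variable {Ω : Type*} [MeasurableSpace Ω] {P : Measure Ω} [IsProbabilityMeasure P]
  {X V W : Ω → ℝ} {σx σv σw b θ A : ℝ}

/-- The gain of the estimator that is optimal for the encoder gain `A`. -/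
def estimatorGain (σx σv σw A : ℝ) : ℝ := (A * σx ^ 2 * σw ^ 2 + σx ^ 2 * σv ^ 2) /
  (A ^ 2 * σx ^ 2 * σw ^ 2 + σx ^ 2 * σv ^ 2 + σw ^ 2 * σv ^ 2)

/-- The linear reaction of the decoder to the linear encoder of gain `A`. -/
def linearDecoder (σx σv σw : ℝ) {A : ℝ} (hA : 0 ≤ A) : Decoder where
  ratio := A * σw ^ 2 / (A * σw ^ 2 + σv ^ 2)
  ratio_mem := ⟨by positivity, div_le_one_of_le₀ (le_add_of_nonneg_right (sq_nonneg σv))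
    (by positivity)⟩
  estimate := fun r => estimatorGain σx σv σw A * r
  measurable_estimate := measurable_const_mul _

lemma memLp_linear (A : ℝ) (vx : ℝ≥0) :
    MemLp (Encoder.linear A).message 2 (gaussianReal 0 vx) :=
  (memLp_id_gaussianReal 2).const_mul A

lemma integral_sq_linear (A σx : ℝ) :
    ∫ x, (Encoder.linear A).message x ^ 2 ∂(gaussianReal 0 (Real.toNNReal (σx ^ 2))) =
      A ^ 2 * σx ^ 2 := by
  simp only [Encoder.linear, mul_pow]
  rw [integral_const_mul, integral_sq_gaussianReal, Real.coe_toNNReal _ (sq_nonneg σx)]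

lemma channelError_linearDecoder (hσx : 0 < σx) (hσv : 0 < σv) (hσw : 0 < σw) (hA : 0 ≤ A) :
    channelError (Real.toNNReal (σx ^ 2)) (noiseVar σv σw (linearDecoder σx σv σw hA).ratio)
      (combinedSignal (Encoder.linear A) (linearDecoder σx σv σw hA).ratio)
      (linearDecoder σx σv σw hA).estimate = ENNReal.ofReal (minError σx σv σw (A ^ 2)) := by
  have hs : combinedSignal (Encoder.linear A) (linearDecoder σx σv σw hA).ratio =
      fun x => ((linearDecoder σx σv σw hA).ratio * A +
        (1 - (linearDecoder σx σv σw hA).ratio)) * x := by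
    funext x
    simp only [combinedSignal, Encoder.linear]
    ring
  rw [hs]
  simp only [linearDecoder]
  rw [channelError_linear, Real.coe_toNNReal _ (sq_nonneg σx), coe_noiseVar]
  congr 1
  have h1 : 1 - A * σw ^ 2 / (A * σw ^ 2 + σv ^ 2) = σv ^ 2 / (A * σw ^ 2 + σv ^ 2) := by
    field_simp
    ring
  rw [h1, minError, estimatorGain]
  have h2 : 1 - (A * σx ^ 2 * σw ^ 2 + σx ^ 2 * σv ^ 2) /
      (A ^ 2 * σx ^ 2 * σw ^ 2 + σx ^ 2 * σv ^ 2 + σw ^ 2 * σv ^ 2) *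
      (A * σw ^ 2 / (A * σw ^ 2 + σv ^ 2) * A + σv ^ 2 / (A * σw ^ 2 + σv ^ 2)) =
      σw ^ 2 * σv ^ 2 / (A ^ 2 * σx ^ 2 * σw ^ 2 + σx ^ 2 * σv ^ 2 + σw ^ 2 * σv ^ 2) := by
    field_simp
    ring
  rw [h2]
  field_simp
  ring

lemma decoderCost_linearDecoder (hσx : 0 < σx) (hσv : 0 < σv) (hσw : 0 < σw)
    (hX : HasLaw X (gaussianReal 0 (Real.toNNReal (σx ^ 2))) P)
    (hV : HasLaw V (gaussianReal 0 (Real.toNNReal (σv ^ 2))) P)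
    (hW : HasLaw W (gaussianReal 0 (Real.toNNReal (σw ^ 2))) P)
    (hindep : iIndepFun ![X, V, W] P) (hA : 0 ≤ A) {γ : Encoder}
    (hγ : γ.message =ᵐ[gaussianReal 0 (Real.toNNReal (σx ^ 2))] fun x => A * x) :
    decoderCost P X V W γ (linearDecoder σx σv σw hA) =
      ENNReal.ofReal (minError σx σv σw (A ^ 2)) := by
  rw [decoderCost_eq_channelError hX hV hW hindep, ← channelError_linearDecoder hσx hσv hσw hA]
  refine channelError_congr ?_ _
  filter_upwards [hγ] with x hx
  rw [combinedSignal, combinedSignal, hx, Encoder.linear]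

lemma isBestResponse_linearDecoder (hσx : 0 < σx) (hσv : 0 < σv) (hσw : 0 < σw)
    (hX : HasLaw X (gaussianReal 0 (Real.toNNReal (σx ^ 2))) P)
    (hV : HasLaw V (gaussianReal 0 (Real.toNNReal (σv ^ 2))) P)
    (hW : HasLaw W (gaussianReal 0 (Real.toNNReal (σw ^ 2))) P)
    (hindep : iIndepFun ![X, V, W] P) (hA : 0 ≤ A) :
    IsBestResponse P X V W (Encoder.linear A) (linearDecoder σx σv σw hA) := fun d' => by
  rw [decoderCost_linearDecoder hσx hσv hσw hX hV hW hindep hA (Filter.EventuallyEq.refl _ _)]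
  exact minError_le_decoderCost hσx hσv hσw hX hV hW hindep (memLp_linear A _) hA
    (integral_sq_linear A σx) d'

/-- All best responses share one decoder cost, and the encoder cost depends on the response only
through it. This allows an arbitrary `d`, since an equilibrium map may answer the linear encoder
with any of them. -/
lemma encoderCost_linear (hσx : 0 < σx) (hσv : 0 < σv) (hσw : 0 < σw) (hθ : 0 < θ)
    (hX : HasLaw X (gaussianReal 0 (Real.toNNReal (σx ^ 2))) P)
    (hV : HasLaw V (gaussianReal 0 (Real.toNNReal (σv ^ 2))) P)
    (hW : HasLaw W (gaussianReal 0 (Real.toNNReal (σw ^ 2))) P)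
    (hindep : iIndepFun ![X, V, W] P) (hA : 0 ≤ A) {d : Decoder}
    (hd : IsBestResponse P X V W (Encoder.linear A) d) :
    encoderCost P X V W b θ (Encoder.linear A) d =
      ENNReal.ofReal (minError σx σv σw (A ^ 2) + θ * A ^ 2 * σx ^ 2 + b ^ 2) := by
  have hcost : decoderCost P X V W (Encoder.linear A) d =
      ENNReal.ofReal (minError σx σv σw (A ^ 2)) := by
    rw [← decoderCost_linearDecoder hσx hσv hσw hX hV hW hindep hA
      (Filter.EventuallyEq.refl _ (Encoder.linear A).message)]
    exact le_antisymm (hd _)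
      (isBestResponse_linearDecoder hσx hσv hσw hX hV hW hindep hA d)
  have hmin : 0 ≤ minError σx σv σw (A ^ 2) := minError_nonneg (sq_nonneg A)
  rw [hd.encoderCost_eq hθ.le hX hV.aemeasurable hW.aemeasurable, hcost,
    ← ofReal_integral_eq_lintegral_ofReal ((memLp_linear A _).integrable_sq.const_mul θ)
    (Filter.Eventually.of_forall fun x => mul_nonneg hθ.le (sq_nonneg _)), integral_const_mul,
    integral_sq_linear, ENNReal.ofReal_add (by positivity) (sq_nonneg b),
    ENNReal.ofReal_add hmin (by positivity), ← mul_assoc]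
  ring

end Linear

/-! ### Equilibria -/

section Equilibrium

variable {Ω : Type*} [MeasurableSpace Ω] {P : Measure Ω} [IsProbabilityMeasure P]
  {X V W : Ω → ℝ} {σx σv σw b θ A : ℝ}

lemma exists_isStackelbergEquilibrium (hσx : 0 < σx) (hσv : 0 < σv) (hσw : 0 < σw) (hθ : 0 < θ)
    (hX : HasLaw X (gaussianReal 0 (Real.toNNReal (σx ^ 2))) P)
    (hV : HasLaw V (gaussianReal 0 (Real.toNNReal (σv ^ 2))) P)
    (hW : HasLaw W (gaussianReal 0 (Real.toNNReal (σw ^ 2))) P)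
    (hindep : iIndepFun ![X, V, W] P) (hA : 0 ≤ A)
    (hstat : IsStationary σx σv σw θ (A ^ 2)) :
    ∃ δ : Encoder → Decoder, IsStackelbergEquilibrium P X V W b θ (Encoder.linear A) δ ∧
      δ (Encoder.linear A) = linearDecoder σx σv σw hA := by
  classical
  choose δ₀ hδ₀ using fun γ : Encoder =>
    exists_isBestResponse hσv hσw hX hV hW hindep γ
  -- Only the reaction to the equilibrium encoder must be explicit; elsewhere any optimal reaction
  -- will do.
  set δ : Encoder → Decoder :=
    Function.update δ₀ (Encoder.linear A) (linearDecoder σx σv σw hA)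
  have hlin : δ (Encoder.linear A) = linearDecoder σx σv σw hA := Function.update_self _ _ _
  have hbest : ∀ γ, IsBestResponse P X V W γ (δ γ) := by
    intro γ
    by_cases h : γ = Encoder.linear A
    · rw [h, hlin]
      exact isBestResponse_linearDecoder hσx hσv hσw hX hV hW hindep hA
    · rw [show δ γ = δ₀ γ from Function.update_of_ne h _ _]
      exact hδ₀ γ
  refine ⟨δ, ⟨hbest, fun γ => ?_⟩, hlin⟩
  rw [encoderCost_linear hσx hσv hσw hθ hX hV hW hindep hA (hbest _)]
  by_cases hfin : encoderCost P X V W b θ γ (δ γ) = ∞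
  · rw [hfin]; exact le_top
  obtain ⟨hγ, a, D, ha, hD, hp, hdec, henc⟩ :=
    (hbest γ).exists_power hσx hθ hX hV.aemeasurable hW.aemeasurable hfin
  have hle := minError_le_decoderCost hσx hσv hσw hX hV hW hindep hγ ha hp (δ γ)
  rw [hdec, ENNReal.ofReal_le_ofReal_iff hD] at hle
  rw [henc]
  have := hstat.tradeoff_le hσv (sq_nonneg A) (sq_nonneg a)
  exact ENNReal.ofReal_le_ofReal (by linarith)

/-- Deviating to the linear encoder bounds the equilibrium cost above, while the trade-off bounds it
below. Both bounds must be tight, which fixes the power and then, by the equality case, the message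
and the ratio. -/
lemma IsStackelbergEquilibrium.eq_linear (hσx : 0 < σx) (hσv : 0 < σv) (hσw : 0 < σw)
    (hθ : 0 < θ)
    (hX : HasLaw X (gaussianReal 0 (Real.toNNReal (σx ^ 2))) P)
    (hV : HasLaw V (gaussianReal 0 (Real.toNNReal (σv ^ 2))) P)
    (hW : HasLaw W (gaussianReal 0 (Real.toNNReal (σw ^ 2))) P)
    (hindep : iIndepFun ![X, V, W] P) (hA : 0 ≤ A)
    (hstat : IsStationary σx σv σw θ (A ^ 2)) {γ : Encoder} {δ : Encoder → Decoder}
    (h : IsStackelbergEquilibrium P X V W b θ γ δ) :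
    (∀ᵐ x, γ.message x = A * x) ∧
      (δ γ).ratio = A * σw ^ 2 / (A * σw ^ 2 + σv ^ 2) ∧
      (∀ᵐ r, (δ γ).estimate r = estimatorGain σx σv σw A * r) ∧
      decoderCost P X V W γ (δ γ) = ENNReal.ofReal (minError σx σv σw (A ^ 2)) ∧
      encoderCost P X V W b θ γ (δ γ) =
        ENNReal.ofReal (minError σx σv σw (A ^ 2) + θ * A ^ 2 * σx ^ 2 + b ^ 2) := by
  have hlead := h.leader (Encoder.linear A)
  rw [encoderCost_linear hσx hσv hσw hθ hX hV hW hindep hA (h.follower _)] at hlead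
  obtain ⟨hγ, a, D, ha, hD, hp, hdec, henc⟩ :=
    (h.follower γ).exists_power hσx hθ hX hV.aemeasurable hW.aemeasurable
      (ne_top_of_le_ne_top ENNReal.ofReal_ne_top hlead)
  have hle := minError_le_decoderCost hσx hσv hσw hX hV hW hindep hγ ha hp (δ γ)
  have hmin : 0 ≤ minError σx σv σw (A ^ 2) := minError_nonneg (sq_nonneg A)
  rw [hdec, ENNReal.ofReal_le_ofReal_iff hD] at hle
  rw [henc, ENNReal.ofReal_le_ofReal_iff (by positivity)] at hlead
  have haA : a = A := (sq_eq_sq₀ ha hA).1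
    (hstat.eq_of_tradeoff_le hσx hσv (sq_nonneg A) (sq_nonneg a) (by linarith))
  subst haA
  have hDeq : D = minError σx σv σw (a ^ 2) := le_antisymm (by linarith) hle
  rw [hDeq] at hdec henc
  obtain ⟨hratio, hmsg⟩ := eq_of_decoderCost_le_minError hσx hσv hσw hX hV hW hindep hγ ha hp
    hdec.le
  have hvx := toNNReal_sq_ne_zero hσx
  -- Lebesgue measure is absolutely continuous with respect to the nondegenerate law of the source.
  refine ⟨(gaussianReal_absolutelyContinuous' 0 hvx).ae_le hmsg, hratio, ?_, hdec, henc⟩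
  set d := δ γ
  have hr : d.ratio = (linearDecoder σx σv σw hA).ratio := hratio
  have hv := noiseVar_ne_zero hσv hσw d.ratio
  have hs := measurable_combinedSignal γ d.ratio
  have hcost : ∀ g : ℝ → ℝ, ∀ hg : Measurable g,
      decoderCost P X V W γ ⟨d.ratio, d.ratio_mem, g, hg⟩ =
      channelError (Real.toNNReal (σx ^ 2)) (noiseVar σv σw d.ratio)
        (combinedSignal γ d.ratio) g := fun g hg =>
    decoderCost_eq_channelError hX hV hW hindep γ ⟨d.ratio, d.ratio_mem, g, hg⟩
  have hd := hcost d.estimate d.measurable_estimate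
  have hopt : ∀ g : ℝ → ℝ, Measurable g →
      channelError (Real.toNNReal (σx ^ 2)) (noiseVar σv σw d.ratio)
        (combinedSignal γ d.ratio) d.estimate ≤
      channelError (Real.toNNReal (σx ^ 2)) (noiseVar σv σw d.ratio)
        (combinedSignal γ d.ratio) g := by
    intro g hg
    rw [← hd, ← hcost g hg]
    exact h.follower γ _
  have hK : channelError (Real.toNNReal (σx ^ 2)) (noiseVar σv σw d.ratio)
      (combinedSignal γ d.ratio) (linearDecoder σx σv σw hA).estimate =
      channelError (Real.toNNReal (σx ^ 2)) (noiseVar σv σw d.ratio)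
        (combinedSignal γ d.ratio) d.estimate := by
    rw [← hd]
    refine Eq.trans ?_ hdec.symm
    rw [hr, ← decoderCost_eq_channelError hX hV hW hindep,
      decoderCost_linearDecoder hσx hσv hσw hX hV hW hindep hA hmsg]
  have hfin : channelError (Real.toNNReal (σx ^ 2)) (noiseVar σv σw d.ratio)
        (combinedSignal γ d.ratio) d.estimate ≠ ∞ := by
    rw [← hd]
    exact (h.follower γ).decoderCost_ne_top hX
  -- The linear estimator has the same minimal error at this ratio, so both estimators agree almost
  -- everywhere with the posterior mean.
  exact (ae_eq_posteriorMean hv hs d.measurable_estimate hfin hopt).trans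
    (ae_eq_posteriorMean hv hs (linearDecoder σx σv σw hA).measurable_estimate
      (by rwa [hK]) (by rwa [hK])).symm

end Equilibrium

end SignalingGame

end

theorem mainTheorem1 {Ω : Type*} [MeasurableSpace Ω] (P : Measure Ω) [IsProbabilityMeasure P]
    (X V W : Ω → ℝ) (σx σv σw b θ : ℝ)
    (hσx : 0 < σx) (hσv : 0 < σv) (hσw : 0 < σw) (hθ : 0 < θ)
    (hX : HasLaw X (gaussianReal 0 (Real.toNNReal (σx ^ 2))) P)
    (hV : HasLaw V (gaussianReal 0 (Real.toNNReal (σv ^ 2))) P)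
    (hW : HasLaw W (gaussianReal 0 (Real.toNNReal (σw ^ 2))) P)
    (hindep : iIndepFun ![X, V, W] P) :
    ∃ A α K Jd : ℝ,
      0 ≤ A ∧ 0 ≤ K ∧
      A ^ 2 = (if θ < σx ^ 2 / (σv ^ 2 * (σx ^ 2 / σw ^ 2 + 1) ^ 2) then
          √(σv ^ 2 / (θ * σx ^ 2)) - σv ^ 2 / σx ^ 2 * (σx ^ 2 / σw ^ 2 + 1)
        else 0) ∧
      (0 < A ↔ θ < σx ^ 2 / (σv ^ 2 * (σx ^ 2 / σw ^ 2 + 1) ^ 2)) ∧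
      α = A * σw ^ 2 / (A * σw ^ 2 + σv ^ 2) ∧
      K = (A * σx ^ 2 * σw ^ 2 + σx ^ 2 * σv ^ 2) /
        (A ^ 2 * σx ^ 2 * σw ^ 2 + σx ^ 2 * σv ^ 2 + σw ^ 2 * σv ^ 2) ∧
      Jd = σx ^ 2 * σw ^ 2 * σv ^ 2 /
        ((A ^ 2 * σw ^ 2 + σv ^ 2) * σx ^ 2 + σw ^ 2 * σv ^ 2) ∧
      (∃ δ : SignalingGame.Encoder → SignalingGame.Decoder,
        SignalingGame.IsStackelbergEquilibrium P X V W b θ (SignalingGame.Encoder.linear A) δ ∧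
        (δ (SignalingGame.Encoder.linear A)).ratio = α ∧
        (δ (SignalingGame.Encoder.linear A)).estimate = fun r => K * r) ∧
      (∀ (γ : SignalingGame.Encoder) (δ : SignalingGame.Encoder → SignalingGame.Decoder),
        SignalingGame.IsStackelbergEquilibrium P X V W b θ γ δ →
          (∀ᵐ x, γ.message x = A * x) ∧
          (δ γ).ratio = α ∧
          (∀ᵐ r, (δ γ).estimate r = K * r) ∧
          SignalingGame.decoderCost P X V W γ (δ γ) = ENNReal.ofReal Jd ∧
          SignalingGame.encoderCost P X V W b θ γ (δ γ) =
            ENNReal.ofReal (Jd + θ * A ^ 2 * σx ^ 2 + b ^ 2)) := by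
  have hq := SignalingGame.optimalGainSq_nonneg (σw := σw) hσx hσv hθ
  have hsq : √(SignalingGame.optimalGainSq σx σv σw θ) ^ 2 =
    SignalingGame.optimalGainSq σx σv σw θ := Real.sq_sqrt hq
  have hstat := SignalingGame.isStationary_optimalGainSq (σw := σw) hσx hσv hθ
  have hpos := Real.sqrt_pos.trans
    (SignalingGame.optimalGainSq_pos_iff (σw := σw) hσx hσv hθ)
  have hA := Real.sqrt_nonneg (SignalingGame.optimalGainSq σx σv σw θ)
  rw [← hsq] at hstat
  -- From here on only `A ≥ 0`, the value of `A²`, the sign criterion and stationarity matter.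
  generalize √(SignalingGame.optimalGainSq σx σv σw θ) = A at *
  have hJ : SignalingGame.minError σx σv σw (A ^ 2) = σx ^ 2 * σw ^ 2 * σv ^ 2 /
      ((A ^ 2 * σw ^ 2 + σv ^ 2) * σx ^ 2 + σw ^ 2 * σv ^ 2) := by
    rw [SignalingGame.minError]
    field_simp
    ring
  refine ⟨A, _, SignalingGame.estimatorGain σx σv σw A, _, hA, ?_, hsq, hpos, rfl, rfl, rfl,
    ?_, fun γ δ h => ?_⟩
  · rw [SignalingGame.estimatorGain]
    positivity
  · obtain ⟨δ, hδ, hlin⟩ := SignalingGame.exists_isStackelbergEquilibrium (b := b)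
      hσx hσv hσw hθ hX hV hW hindep hA hstat
    exact ⟨δ, hδ, by rw [hlin]; rfl, by rw [hlin]; rfl⟩
  · rw [← hJ]
    exact h.eq_linear hσx hσv hσw hθ hX hV hW hindep hA hstat
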